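/- A *system* $A$ consists of: a compact convex set $\mathcal S_A$ of states spanning a finite-dimensional real vector space $V_A$ and lying in the hyperplane $\mathbf 1_A=1$ of a linear functional $\mathbf 1_A$; a closed convex set of allowed effects (linear functionals on $V_A$ with values in $[0,1]$ on $\mathcal S_A$) which contains $\mathbf 1_A$, contains $\mathbf 1_A-E$ whenever it contains $E$, and separates states; and a closed group $\mathcal G_A$ of invertible linear maps of $V_A$ (the reversible transformations) that map $\mathcal S_A$ onto itself and preserve the set of allowed effects. A *measurement* is a finite tuple of allowed effects with sum $\mathbf 1_A$; states $\omega_1,\dots,\omega_n$ are *distinguishable* if some measurement satisfies $E_i(\omega_j)=\delta_{ij}$; the *capacity* of $A$ is the maximal size of a set of distinguishable states, and a measurement is *complete* if it distinguishes that many states. *Pure states* are the extreme points of $\mathcal S_A$. A *composite* $AB$ of $A$ and $B$ is a system with bilinear products $(a,b)\mapsto a\otimes b\in V_{AB}$ of vectors and $(E,F)\mapsto E\otimes F\in V_{AB}^*$ of functionals, taking pairs of states to states and pairs of allowed effects to allowed effects, such that $(E\otimes F)(a\otimes b)=E(a)F(b)$ and $\mathbf 1_A\otimes\mathbf 1_B=\mathbf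 1_{AB}$, such that conditional states of each part given an outcome on the other part are states of that part, and such that $\mathcal G_{AB}$ contains $S\otimes T$ for all $S\in\mathcal G_A$, $T\in\mathcal G_B$. A *theory* is a collection of systems containing systems of every capacity $N\ge1$, with a composite (again in the collection) for every two of its systems. Consider a theory satisfying the following four postulates. 1. (Local tomography) If $(E\otimes F)(\omega)=(E\otimes F)(\varphi)$ for all allowed effects $E$ on $A$ and $F$ on $B$, where $\omega,\varphi\in\mathcal S_{AB}$, then $\omega=\varphi$. 2. (Equivalence of subspaces) If $A$ and $B$ have capacities $N$ and $N-1$ and $E_1,\dots,E_N$ is a complete measurement on $A$, then $\mathcal S'=\{\omega\in\mathcal S_A: E_N(\omega)=0\}$ is equivalent to $B$: there is a linear isomorphism $L:V_B\to\operatorname{span}\mathcal S'$ with $L(\mathcal S_B)=\mathcal S'$, under which the allowed effects on $B$ correspond to the restrictions to $\operatorname{span}\mathcal S'$ of the allowed effects on $A$, and $\mathcal G_B$ corresponds to the set of restrictions to $\operatorname{span}\mathcal S'$ of those $T\in\mathcal G_A$ with $T\mathcal S'=\mathcal S'$. 3. (Symmetry) On every system, $\mathcal G_A$ acts transitively on the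 pure states. 4. (All measurements allowed) On systems of capacity 2, every linear functional with values in $[0,1]$ on the states is an allowed effect. Let $A$ and $B$ be bits, i.e. systems of capacity $2$ of the theory, and let $\mathcal S_{2,2}$ and $\mathcal G_{2,2}$ be the state space and the group of reversible transformations of their composite $AB$. Then, for some $d$, both bits admit *ball coordinates*, i.e. linear isomorphisms $L_A:V_A\to\mathbb R^{d+1}$ and $L_B:V_B\to\mathbb R^{d+1}$ mapping the state space onto $\{(1,x): x\in\mathbb R^d,\ \|x\|\le1\}$. Moreover, for every $d$ and all such ball coordinates $L_A,L_B$, there is a linear isomorphism $\Phi:V_{AB}\to\mathbb R^{d+1}\otimes\mathbb R^{d+1}$ with $\Phi(a\otimes b)=L_A(a)\otimes L_B(b)$ for all $a,b$, and for every reversible transformation $T\in\mathcal G_{2,2}$ the matrix of $\Phi T\Phi^{-1}$ in the standard product basis of $\mathbb R^{d+1}\otimes\mathbb R^{d+1}$ is orthogonal. In particular, if the bit is a three-dimensional ball ($d=3$), every $T\in\mathcal G_{2,2}$ acts as an orthogonal matrix on $\mathbb R^4\otimes\mathbb R^4$. -/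

import Mathlib

namespace GPT

/-- A (finite-dimensional) physical system: a compact convex state space spanning `ℝ^K`, the
normalization functional `𝟏` (the trivial effect), the set of physically allowed effects, and
the group of reversible transformations. -/
structure System where
  /-- `K` is the dimension of the space carrying the unnormalized states. -/
  K : ℕ
  /-- The trivial effect, giving unit probability on every normalized state. -/
  unit : (Fin K → ℝ) →L[ℝ] ℝ
  states : Set (Fin K → ℝ)
  effects : Set ((Fin K → ℝ) →L[ℝ] ℝ)
  G : Subgroup ((Fin K → ℝ) ≃L[ℝ] (Fin K → ℝ))
  states_nonempty : states.Nonempty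
  states_convex : Convex ℝ states
  states_compact : IsCompact states
  states_normalized : ∀ ω ∈ states, unit ω = 1
  /-- The ambient space is the space of unnormalized states: `K = dim states + 1`. -/
  states_span : Submodule.span ℝ states = ⊤
  effects_prob : ∀ E ∈ effects, ∀ ω ∈ states, 0 ≤ E ω ∧ E ω ≤ 1
  effects_closed : IsClosed effects
  effects_convex : Convex ℝ effects
  unit_mem : unit ∈ effects
  /-- Every allowed effect is part of a two-outcome measurement. -/
  compl_mem : ∀ E ∈ effects, unit - E ∈ effects
  /-- A state is determined by the outcome probabilities of the possible measurements. -/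
  effects_separate : ∀ ω ∈ states, ∀ φ ∈ states, (∀ E ∈ effects, E ω = E φ) → ω = φ
  /-- Reversible transformations map the state space onto itself. -/
  G_states : ∀ T ∈ G, T '' states = states
  /-- The group of reversible transformations is a topologically closed set of linear maps. -/
  G_closed : IsClosed
    ((fun T : (Fin K → ℝ) ≃L[ℝ] (Fin K → ℝ) => (T : (Fin K → ℝ) →L[ℝ] (Fin K → ℝ))) ''
      (G : Set ((Fin K → ℝ) ≃L[ℝ] (Fin K → ℝ))))
  G_effects : ∀ T ∈ G, ∀ E ∈ effects,
    E.comp (T : (Fin K → ℝ) →L[ℝ] (Fin K → ℝ)) ∈ effects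

namespace System

/-- The real vector space carrying the (unnormalized) states of `A`. -/
abbrev V (A : System) : Type := Fin A.K → ℝ

/-- Pure states: the extremal points of the state space. -/
def pureStates (A : System) : Set A.V := A.states.extremePoints ℝ

/-- An `n`-outcome measurement: allowed effects which sum up to the trivial effect. -/
def IsMeasurement (A : System) {n : ℕ} (E : Fin n → (A.V →L[ℝ] ℝ)) : Prop :=
  (∀ i, E i ∈ A.effects) ∧ ∑ i, E i = A.unit

/-- The effects `E` distinguish the tuple of states `ω` perfectly: `E i (ω j) = δ i j`. -/
def Distinguishes (A : System) {n : ℕ} (E : Fin n → (A.V →L[ℝ] ℝ)) (ω : Fin n → A.V) : Prop :=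
  A.IsMeasurement E ∧ (∀ j, ω j ∈ A.states) ∧ ∀ i j, E i (ω j) = if i = j then 1 else 0

/-- `N` is the capacity of `A`: the maximal number of perfectly distinguishable states. -/
def HasCapacity (A : System) (N : ℕ) : Prop :=
  IsGreatest {n : ℕ | ∃ (E : Fin n → (A.V →L[ℝ] ℝ)) (ω : Fin n → A.V), A.Distinguishes E ω} N

/-- A complete measurement: it distinguishes as many states as the capacity of `A`. -/
def IsCompleteMeasurement (A : System) {N : ℕ} (E : Fin N → (A.V →L[ℝ] ℝ)) : Prop :=
  A.HasCapacity N ∧ ∃ ω : Fin N → A.V, A.Distinguishes E ω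

/-- The set of states on which the effect `E` has probability zero. -/
def zeroFace (A : System) (E : A.V →L[ℝ] ℝ) : Set A.V := {ω ∈ A.states | E ω = 0}

/-- The set of states `S' = {ω | E ω = 0}` of `A`, with the effects and the reversible
transformations that it inherits from `A`, is equivalent to the system `B`:
there is an invertible linear map `L : V_B → span S'` such that
* `L` maps the states of `B` onto `S'`;
* the allowed effects on `B` correspond to the restrictions to `span S'` of allowed effects on `A`;
* the reversible transformations on `B` correspond to the restrictions to `span S'` of the
  reversible transformations `T` on `A` with `T S' = S'`. -/
def ZeroFaceEquivalent (A : System) (E : A.V →L[ℝ] ℝ) (B : System) : Prop :=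
  ∃ L : B.V ≃ₗ[ℝ] Submodule.span ℝ (A.zeroFace E),
    (fun v => (L v : A.V)) '' B.states = A.zeroFace E ∧
    (∀ F : B.V →L[ℝ] ℝ, F ∈ B.effects ↔ ∃ E' ∈ A.effects, ∀ v, F v = E' (L v)) ∧
    (∀ U : B.V ≃L[ℝ] B.V, U ∈ B.G ↔
      ∃ T ∈ A.G, T '' A.zeroFace E = A.zeroFace E ∧ ∀ v, T (L v) = L (U v))

/-- Ball coordinates on `A`: a linear identification of `V_A` with `ℝ^(d+1)` under which the
state space is `{(1, x) | x ∈ ℝ^d, ‖x‖ ≤ 1}` (Euclidean norm). -/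
def IsBallCoordinates (A : System) (d : ℕ) (L : A.V ≃ₗ[ℝ] (Fin (d + 1) → ℝ)) : Prop :=
  L '' A.states = {x | x 0 = 1 ∧ ∑ i : Fin d, x i.succ ^ 2 ≤ 1}

end System

/-- `AB` is a composite of `A` and `B`. Independent preparation and independent measurement are
affine in both arguments on states and effects, hence are given by bilinear maps
`(a, b) ↦ a ⊗ b` and `(E, F) ↦ E ⊗ F` on the spaces that these span. -/
structure Composite (A B AB : System) where
  st : A.V →ₗ[ℝ] B.V →ₗ[ℝ] AB.V
  eff : (A.V →L[ℝ] ℝ) →ₗ[ℝ] (B.V →L[ℝ] ℝ) →ₗ[ℝ] (AB.V →L[ℝ] ℝ)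
  st_mem : ∀ a ∈ A.states, ∀ b ∈ B.states, st a b ∈ AB.states
  eff_mem : ∀ E ∈ A.effects, ∀ F ∈ B.effects, eff E F ∈ AB.effects
  eff_st : ∀ E F a b, eff E F (st a b) = E a * F b
  eff_unit : eff A.unit B.unit = AB.unit
  /-- The state of `A` conditional on an outcome on `B` is a state of `A`. -/
  cond_left : ∀ ω ∈ AB.states, ∀ F ∈ B.effects, eff A.unit F ω ≠ 0 →
    ∃ a ∈ A.states, ∀ E ∈ A.effects, E a = eff E F ω / eff A.unit F ω
  /-- The state of `B` conditional on an outcome on `A` is a state of `B`. -/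
  cond_right : ∀ ω ∈ AB.states, ∀ E ∈ A.effects, eff E B.unit ω ≠ 0 →
    ∃ b ∈ B.states, ∀ F ∈ B.effects, F b = eff E F ω / eff E B.unit ω
  /-- Local reversible transformations `S ⊗ T` are reversible transformations of `AB`. -/
  local_trans : ∀ S ∈ A.G, ∀ T ∈ B.G, ∃ R ∈ AB.G,
    (∀ a b, R (st a b) = st (S a) (T b)) ∧
    ∀ E F ω, eff E F (R ω) =
      eff (E.comp (S : A.V →L[ℝ] A.V)) (F.comp (T : B.V →L[ℝ] B.V)) ω

/-- Global states are determined by the statistics of local measurement outcomes. -/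
def Composite.LocallyTomographic {A B AB : System} (C : Composite A B AB) : Prop :=
  ∀ ω ∈ AB.states, ∀ φ ∈ AB.states,
    (∀ E ∈ A.effects, ∀ F ∈ B.effects, C.eff E F ω = C.eff E F φ) → ω = φ

universe u

/-- A general probabilistic theory: a collection of systems, containing systems of every
capacity `N ≥ 1`, with a composite for any two systems. -/
structure Theory where
  Sys : Type u
  sys : Sys → System
  comp : Sys → Sys → Sys
  composite : ∀ A B, Composite (sys A) (sys B) (sys (comp A B))
  exists_capacity : ∀ N : ℕ, 1 ≤ N → ∃ A, (sys A).HasCapacity N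

namespace Theory

/-- Postulate "Local tomography". -/
def LocalTomography (𝒯 : Theory.{u}) : Prop :=
  ∀ A B, (𝒯.composite A B).LocallyTomographic

/-- Postulate "Equivalence of subspaces": for systems `A`, `B` of capacities `N` and `N - 1`
(here `N = M + 1`) and any complete measurement `E₁, …, E_N` on `A`, the set of states of `A` with
`E_N ω = 0` is equivalent to `B`. -/
def SubspaceEquivalence (𝒯 : Theory.{u}) : Prop :=
  ∀ (A B : 𝒯.Sys) (M : ℕ), (𝒯.sys A).HasCapacity (M + 1) → (𝒯.sys B).HasCapacity M →
    ∀ E : Fin (M + 1) → ((𝒯.sys A).V →L[ℝ] ℝ), (𝒯.sys A).IsCompleteMeasurement E →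
      (𝒯.sys A).ZeroFaceEquivalent (E (Fin.last M)) (𝒯.sys B)

/-- Postulate "Symmetry": reversible transformations act transitively on the pure states. -/
def Symmetry (𝒯 : Theory.{u}) : Prop :=
  ∀ A, ∀ ω ∈ (𝒯.sys A).pureStates, ∀ φ ∈ (𝒯.sys A).pureStates, ∃ T ∈ (𝒯.sys A).G, T ω = φ

/-- Postulate "All measurements allowed": on a system of capacity `2`, every linear functional
with values in `[0, 1]` on the states is an allowed effect. -/
def AllBitEffectsAllowed (𝒯 : Theory.{u}) : Prop :=
  ∀ A, (𝒯.sys A).HasCapacity 2 → ∀ E : (𝒯.sys A).V →L[ℝ] ℝ,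
    (∀ ω ∈ (𝒯.sys A).states, 0 ≤ E ω ∧ E ω ≤ 1) → E ∈ (𝒯.sys A).effects

/-- The four postulates. -/
structure Postulates (𝒯 : Theory.{u}) : Prop where
  localTomography : 𝒯.LocalTomography
  subspaceEquivalence : 𝒯.SubspaceEquivalence
  symmetry : 𝒯.Symmetry
  allBitEffectsAllowed : 𝒯.AllBitEffectsAllowed

end Theory

end GPT

/-!
The bit is a ball because all of its proper exposed faces are single points: a face of a bit is
equivalent to a system of capacity `1`, and such a system is also equivalent to an exposed point of
the bit. With a Euclidean structure invariant under the reversible transformations, the pure states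
lie on a sphere, and a nearest-point argument shows that the state space is the full ball
(`GPT.Theory.Postulates.exists_isBallCoordinates`).

The maximally mixed state of a composite is the product of the maximally mixed states of its parts
(`GPT.Composite.eq_st_of_isInvariantState`). Starting from the two antipodes of a bit, one finds in
every capacity `N` a set of `N` distinguishable pure states whose uniform mixture is maximally mixed
(`GPT.Theory.Postulates.exists_hasMixingBasis`), and the capacity turns out to be multiplicative
(`GPT.Theory.Postulates.hasMixingBasis_comp`). By local tomography the dimension `K` of the state
cone is then a completely multiplicative function of the capacity, and it is strictly increasing.
Hence `K N = N ^ r` with a natural number `r`, `d + 1 = K 2` is even and `d` is odd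
(`even_apply_two_of_multiplicative`).

Now take an invariant inner product `g` on the composite of two bits, of capacity `4`. Given four
distinguishable states that mix to the maximally mixed state, the stabilizer of one of them is
transitive on the other three, since it acts on a face of capacity `3`. Therefore `g` has the same
value `q` on all pairs of states from a quadruple `x ⊗ y`, `x ⊗ (-y)`, `(-x) ⊗ y'`, `(-x) ⊗ (-y')`
(`GPT.Theory.Postulates.apply_quadruple`). Subtracting `q (𝟏 ⊗ 𝟏)` from `g` gives an invariant form
for which these states are orthogonal. As a form in the first factor it is invariant under the
transformations of the bit, and antipodes are orthogonal. This forces its symmetric part to be a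
multiple of the dot product, and its alternating part vanishes, because an alternating form in odd
dimension has a kernel and the bit is symmetric (`bilin_eq_mul_dotProduct_of_invariant`). The same
holds in the second factor. So the dot product of the product coordinates is invariant.
-/

/-! ### Completely multiplicative increasing functions on the positive integers -/

/-- Mean value theorem for iterated forward differences: if `H 0, H 1, …` are successive
derivatives on the positive half-line, then the `k`-th difference of `H 0` with step `1` is a value
of `H k`. -/
theorem exists_fwdDiff_iter_eq_deriv_chain (k : ℕ) : ∀ (H : ℕ → ℝ → ℝ),
    (∀ i, ∀ x > 0, HasDerivAt (H i) (H (i + 1) x) x) →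
    ∀ x > 0, ∃ ξ ≥ x, (fwdDiff (1 : ℝ))^[k] (H 0) x = H k ξ := by
  induction k with
  | zero => intro H _ x _; exact ⟨x, le_rfl, rfl⟩
  | succ k ih =>
    intro H hH x hx
    obtain ⟨ξ, hξ, h⟩ := ih (fun i => fwdDiff 1 (H i)) (fun i y hy => by
      have h1 := (hH i (y + 1) (by linarith)).comp_add_const y 1
      exact h1.sub (hH i y hy)) x hx
    have hξ0 : 0 < ξ := lt_of_lt_of_le hx hξ
    obtain ⟨η, hη, he⟩ := exists_hasDerivAt_eq_slope (H k) (H (k + 1)) (a := ξ) (b := ξ + 1)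
      (by linarith)
      (fun y hy => (hH k y (by linarith [hy.1])).continuousAt.continuousWithinAt)
      (fun y hy => hH k y (by linarith [hy.1]))
    refine ⟨η, by linarith [hη.1], ?_⟩
    rw [Function.iterate_succ_apply, h, he]
    simp [fwdDiff]

/-- Iterated differences with step `1` of a function taking integer values on the positive
integers are integers there. -/
theorem fwdDiff_iter_intCast_of_forall (k : ℕ) : ∀ (h : ℝ → ℝ),
    (∀ n : ℕ, 1 ≤ n → ∃ z : ℤ, h n = z) →
    ∀ n : ℕ, 1 ≤ n → ∃ z : ℤ, (fwdDiff (1 : ℝ))^[k] h n = z := by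
  induction k with
  | zero => intro h hh; exact hh
  | succ k ih =>
    intro h hh n hn
    rw [Function.iterate_succ_apply]
    refine ih _ (fun m hm => ?_) n hn
    obtain ⟨z, hz⟩ := hh m hm
    obtain ⟨w, hw⟩ := hh (m + 1) (by omega)
    refine ⟨w - z, ?_⟩
    push_cast at hw
    simp [fwdDiff, hz, hw]

/-- A real exponent `r` for which all powers `n ^ r` are integers is a natural number:
otherwise a high-order difference of `n ↦ n ^ r` is a nonzero integer that tends to `0`. -/
theorem exists_natCast_eq_of_rpow_integral {r : ℝ}
    (h : ∀ n : ℕ, 1 ≤ n → ∃ z : ℤ, (n : ℝ) ^ r = z) : ∃ m : ℕ, r = m := by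
  by_contra! hne
  set k := ⌊r⌋₊ + 1 with hk
  have hrk : r < k := by rw [hk]; push_cast; exact Nat.lt_floor_add_one r
  set H : ℕ → ℝ → ℝ := fun i x => (∏ l ∈ Finset.range i, (r - l)) * x ^ (r - i) with hH
  set c : ℝ := ∏ l ∈ Finset.range k, (r - l) with hc
  have hc0 : c ≠ 0 := Finset.prod_ne_zero_iff.2 fun l _ => sub_ne_zero.2 (hne l)
  have hder : ∀ i, ∀ x > 0, HasDerivAt (H i) (H (i + 1) x) x := by
    intro i x hx
    have := (Real.hasDerivAt_rpow_const (x := x) (p := r - i) (Or.inl hx.ne')).const_mul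
      (∏ l ∈ Finset.range i, (r - l))
    refine this.congr_deriv ?_
    change _ = (∏ l ∈ Finset.range (i + 1), (r - l)) * x ^ (r - (i + 1 : ℕ))
    rw [Finset.prod_range_succ]
    push_cast
    rw [mul_assoc, sub_sub]
  have hlim : Filter.Tendsto (H k) Filter.atTop (nhds 0) := by
    have := (tendsto_rpow_neg_atTop (y := k - r) (by linarith)).const_mul c
    simpa [hH, neg_sub] using this
  obtain ⟨X, hX⟩ := Filter.eventually_atTop.1
    ((hlim.eventually (Metric.ball_mem_nhds (0 : ℝ) one_pos)))
  obtain ⟨n, hn⟩ := exists_nat_ge (max X 1)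
  have hn1 : 1 ≤ n := by exact_mod_cast (le_max_right X 1).trans hn
  obtain ⟨ξ, hξ, he⟩ := exists_fwdDiff_iter_eq_deriv_chain k H hder n
    (by exact_mod_cast hn1)
  obtain ⟨z, hz⟩ := fwdDiff_iter_intCast_of_forall k (H 0)
    (fun m hm => by simpa [hH] using h m hm) n hn1
  have hξX : X ≤ ξ := (le_max_left X 1).trans (hn.trans hξ)
  have hξ0 : 0 < ξ := lt_of_lt_of_le (by exact_mod_cast hn1) hξ
  have h1 := hX ξ hξX
  rw [← he, hz, dist_zero_right, Int.norm_cast_real, Int.norm_eq_abs] at h1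
  have hz0 : z = 0 := by
    have : |z| < 1 := by exact_mod_cast h1
    exact Int.abs_lt_one_iff.1 this
  rw [hz, hz0] at he
  have : H k ξ ≠ 0 := mul_ne_zero hc0 (Real.rpow_pos_of_pos hξ0 _).ne'
  exact this (by rw [← he]; simp)

/-- A completely multiplicative, strictly increasing function on the positive integers has
constant ratio `log f n / log n`. -/
theorem log_mul_log_eq_of_multiplicative {f : ℕ → ℕ} (h1 : f 1 = 1)
    (hmul : ∀ m n, 1 ≤ m → 1 ≤ n → f (m * n) = f m * f n)
    (hmono : ∀ m n, 1 ≤ m → m < n → f m < f n) {n : ℕ} (hn : 1 ≤ n) :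
    Real.log (f n) * Real.log 2 = Real.log (f 2) * Real.log n := by
  have hpos : ∀ m, 1 ≤ m → 1 ≤ f m := by
    intro m hm
    rcases hm.eq_or_lt with rfl | hm
    · exact h1.ge
    · exact h1.ge.trans (hmono 1 m le_rfl hm).le
  have hle : ∀ m n, 1 ≤ m → m ≤ n → f m ≤ f n := by
    intro m n hm hmn
    rcases hmn.eq_or_lt with rfl | h
    · exact le_rfl
    · exact (hmono m n hm h).le
  have hpow : ∀ m k, 1 ≤ m → f (m ^ k) = f m ^ k := by
    intro m k hm
    induction k with
    | zero => simpa using h1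
    | succ k ih => rw [pow_succ, hmul _ _ (Nat.one_le_pow _ _ hm) hm, ih, pow_succ]
  set a := Real.log (f n)
  set b := Real.log (f 2)
  set α := Real.log n
  set β := Real.log 2
  have hb : 0 ≤ b := Real.log_natCast_nonneg _
  have hβ : 0 < β := Real.log_pos (by norm_num)
  have key : ∀ k : ℕ, k * |a * β - b * α| ≤ b * β := by
    intro k
    set j := Nat.log 2 (n ^ k)
    have hnk : n ^ k ≠ 0 := pow_ne_zero _ (by omega)
    have hj1 : 2 ^ j ≤ n ^ k := Nat.pow_log_le_self 2 hnk
    have hj2 : n ^ k < 2 ^ (j + 1) := Nat.lt_pow_succ_log_self (by norm_num) _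
    have hf1 : f 2 ^ j ≤ f n ^ k := by
      rw [← hpow 2 j (by norm_num), ← hpow n k hn]
      exact hle _ _ (Nat.one_le_pow _ _ (by norm_num)) hj1
    have hf2 : f n ^ k ≤ f 2 ^ (j + 1) := by
      rw [← hpow 2 (j + 1) (by norm_num), ← hpow n k hn]
      exact hle _ _ (Nat.one_le_pow _ _ hn) hj2.le
    have logle : ∀ {x y p q : ℕ}, 1 ≤ x → x ^ p ≤ y ^ q →
        (p : ℝ) * Real.log x ≤ q * Real.log y := by
      intro x y p q hx hxy
      rw [← Real.log_pow, ← Real.log_pow]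
      refine Real.log_le_log (by positivity) (by exact_mod_cast hxy)
    have e1 : (j : ℝ) * β ≤ k * α := by simpa using logle (by norm_num) hj1
    have e2 : (k : ℝ) * α ≤ (j + 1) * β := by simpa using logle hn hj2.le
    have e3 : (j : ℝ) * b ≤ k * a := logle (hpos 2 (by norm_num)) hf1
    have e4 : (k : ℝ) * a ≤ (j + 1) * b := by simpa using logle (hpos n hn) hf2
    rw [← Nat.abs_cast k, ← abs_mul, abs_le]
    constructor <;> nlinarith
  by_contra hne
  have hpos' : 0 < |a * β - b * α| := abs_pos.2 (sub_ne_zero.2 hne)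
  obtain ⟨k, hk⟩ := exists_nat_gt (b * β / |a * β - b * α|)
  rw [div_lt_iff₀ hpos'] at hk
  exact absurd (key k) (not_le.2 hk)

/-- A completely multiplicative, strictly increasing function on the positive integers is
`n ↦ n ^ m` for a natural number `m ≥ 1`; hence its value at `2` is even. -/
theorem even_apply_two_of_multiplicative {f : ℕ → ℕ} (h1 : f 1 = 1)
    (hmul : ∀ m n, 1 ≤ m → 1 ≤ n → f (m * n) = f m * f n)
    (hmono : ∀ m n, 1 ≤ m → m < n → f m < f n) : Even (f 2) := by
  have hf2 : 1 < f 2 := h1 ▸ hmono 1 2 le_rfl (by norm_num)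
  have hβ : 0 < Real.log 2 := Real.log_pos (by norm_num)
  set r := Real.log (f 2) / Real.log 2 with hr
  have hpow : ∀ n : ℕ, 1 ≤ n → (n : ℝ) ^ r = f n := by
    intro n hn
    have hfn : 0 < f n := by
      rcases hn.eq_or_lt with rfl | hn
      · omega
      · have := hmono 1 n le_rfl hn; omega
    rw [Real.rpow_def_of_pos (by exact_mod_cast hn)]
    have := log_mul_log_eq_of_multiplicative h1 hmul hmono hn
    rw [hr, mul_div_assoc', mul_comm (Real.log (n : ℝ)), ← this, mul_div_cancel_right₀ _ hβ.ne',
      Real.exp_log (by exact_mod_cast hfn)]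
  obtain ⟨m, hm⟩ := exists_natCast_eq_of_rpow_integral (r := r)
    (fun n hn => ⟨f n, by
      rw [hpow n hn]; simp⟩)
  have h2 := hpow 2 (by norm_num)
  rw [hm, Real.rpow_natCast] at h2
  have h3 : 2 ^ m = f 2 := by exact_mod_cast h2
  have hm0 : m ≠ 0 := by rintro rfl; simp at h3; omega
  rw [← h3]
  exact (Nat.even_pow' hm0).2 even_two

/-! ### The invariant Euclidean structure of a compact spanning set -/

section

open MeasureTheory Matrix

open scoped MatrixOrder ComplexOrder Matrix.Norms.L2Operator in
theorem Matrix.PosDef.exists_isUnit_transpose_mul_self {n : Type*} [Fintype n] [DecidableEq n]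
    {M : Matrix n n ℝ} (hM : M.PosDef) : ∃ C : Matrix n n ℝ, IsUnit C ∧ M = Cᵀ * C := by
  obtain ⟨y, hy⟩ := CStarAlgebra.nonneg_iff_eq_star_mul_self.mp hM.posSemidef.nonneg
  rw [star_eq_conjTranspose, conjTranspose_eq_transpose_of_trivial] at hy
  refine ⟨y, ?_, hy⟩
  have h := hM.isUnit
  rw [Matrix.isUnit_iff_isUnit_det, hy, Matrix.det_mul] at h
  exact (Matrix.isUnit_iff_isUnit_det y).2 (isUnit_of_mul_isUnit_right h)

/-- A linear functional that does not vanish identically has positive second moment over a bounded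
set with nonempty interior. -/
theorem setIntegral_dotProduct_sq_pos {K : ℕ} {D : Set (Fin K → ℝ)} (hc : IsCompact D)
    (hi : (interior D).Nonempty) {c : Fin K → ℝ} (hc0 : c ≠ 0) :
    0 < ∫ x in D, (c ⬝ᵥ x) ^ 2 := by
  have hcont : Continuous fun x : Fin K → ℝ => (c ⬝ᵥ x) ^ 2 := by
    unfold dotProduct; fun_prop
  rw [setIntegral_pos_iff_support_of_nonneg_ae (Filter.Eventually.of_forall fun x => sq_nonneg _)
    (hcont.continuousOn.integrableOn_compact hc)]
  set U := interior D ∩ Function.support fun x : Fin K → ℝ => (c ⬝ᵥ x) ^ 2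
  have hU : IsOpen U := isOpen_interior.inter hcont.isOpen_support
  refine lt_of_lt_of_le (hU.measure_pos volume ?_)
    (measure_mono fun x hx => ⟨hx.2, interior_subset hx.1⟩)
  by_contra hne
  obtain ⟨x, hx⟩ := hi
  have hz : ∀ y ∈ interior D, c ⬝ᵥ y = 0 := by
    intro y hy
    by_contra h
    exact hne ⟨y, hy, by simpa using h⟩
  have hcl : Continuous fun t : ℝ => x + t • c := by fun_prop
  have hev : ∀ᶠ t in nhds (0 : ℝ), x + t • c ∈ interior D :=
    hcl.continuousAt.eventually_mem (isOpen_interior.mem_nhds (by simpa using hx))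
  obtain ⟨ε, hε, hball⟩ := Metric.eventually_nhds_iff.1 hev
  have h1 := hz _ (hball (y := ε / 2) (by
    rw [Real.dist_eq, sub_zero, abs_of_pos (by positivity)]; linarith))
  rw [dotProduct_add, hz x hx, dotProduct_smul, zero_add, smul_eq_mul] at h1
  have : c ⬝ᵥ c = 0 := by
    rcases mul_eq_zero.1 h1 with h | h
    · linarith
    · exact h
  exact hc0 (dotProduct_self_eq_zero.1 this)

/-- A linear equivalence mapping a body of positive finite volume onto itself preserves volume. -/
theorem measurePreserving_of_image_eq {K : ℕ} {D : Set (Fin K → ℝ)} (hc : IsCompact D)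
    (hi : (interior D).Nonempty) (T : (Fin K → ℝ) ≃L[ℝ] (Fin K → ℝ)) (hT : T '' D = D) :
    MeasurePreserving T (volume : Measure (Fin K → ℝ)) volume := by
  refine ⟨T.continuous.measurable, ?_⟩
  set f : (Fin K → ℝ) →ₗ[ℝ] (Fin K → ℝ) := T.toLinearEquiv.toLinearMap
  have hf : (f : (Fin K → ℝ) → (Fin K → ℝ)) = T := rfl
  have hD0 : volume D ≠ 0 :=
    (lt_of_lt_of_le (isOpen_interior.measure_pos volume hi) (measure_mono interior_subset)).ne'
  have h1 := Measure.addHaar_image_linearMap (volume : Measure (Fin K → ℝ)) f D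
  rw [hf, hT] at h1
  have h2 : ENNReal.ofReal |LinearMap.det f| = 1 := by
    have := (ENNReal.mul_eq_right hD0 hc.measure_lt_top.ne).1 h1.symm
    exact this
  have h3 : |LinearMap.det f| = 1 := by simpa using h2
  have h0 : LinearMap.det f ≠ 0 := by intro h; rw [h] at h3; simp at h3
  rw [← hf, Measure.map_linearMap_addHaar_eq_smul_addHaar _ h0, abs_inv, h3]
  simp

/-- A compact set that spans has an invariant Euclidean structure: there is a linear
identification with Euclidean space under which every linear equivalence mapping the set onto itself
is an isometry. It is the dual of the quadratic form `c ↦ ∫ (c ⬝ᵥ x) ^ 2` of second moments of the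
closed convex hull of the set and the origin. -/
theorem exists_euclidean_of_isCompact_span {K : ℕ} {S : Set (Fin K → ℝ)} (hS : IsCompact S)
    (hspan : Submodule.span ℝ S = ⊤) :
    ∃ Q : (Fin K → ℝ) ≃ₗ[ℝ] EuclideanSpace ℝ (Fin K),
      ∀ T : (Fin K → ℝ) ≃L[ℝ] (Fin K → ℝ), T '' S = S →
        ∀ v w, inner ℝ (Q (T v)) (Q (T w)) = inner ℝ (Q v) (Q w) := by
  set D := closure (convexHull ℝ (insert 0 S)) with hD
  have hDc : IsCompact D :=
    Metric.isCompact_of_isClosed_isBounded isClosed_closure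
      ((isBounded_convexHull.2 (hS.insert 0).isBounded).closure)
  have hDi : (interior D).Nonempty := by
    have : affineSpan ℝ (insert 0 S) = ⊤ := by
      apply SetLike.coe_injective
      rw [affineSpan_insert_zero, hspan]; rfl
    exact (interior_convexHull_nonempty_iff_affineSpan_eq_top.2 this).mono
      (interior_mono subset_closure)
  have hDT : ∀ T : (Fin K → ℝ) ≃L[ℝ] (Fin K → ℝ), T '' S = S → T '' D = D := by
    intro T hT
    have h1 := (T : (Fin K → ℝ) →ₗ[ℝ] (Fin K → ℝ)).image_convexHull (insert 0 S)
    have h2 : (T : (Fin K → ℝ) →ₗ[ℝ] (Fin K → ℝ)) '' (insert 0 S) = insert 0 S := by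
      rw [Set.image_insert_eq, map_zero]
      exact congrArg _ hT
    rw [h2] at h1
    have h3 := T.image_closure (convexHull ℝ (insert 0 S))
    exact h3.trans (congrArg closure h1)
  set M : Matrix (Fin K) (Fin K) ℝ := Matrix.of fun i j => ∫ x in D, x i * x j with hM
  -- `M` is the matrix of second moments of the invariant body `D`; the form sought is `M⁻¹`
  have hint : ∀ i j, IntegrableOn (fun x : Fin K → ℝ => x i * x j) D := fun i j =>
    (Continuous.continuousOn (by fun_prop)).integrableOn_compact hDc
  have hquad : ∀ c e : Fin K → ℝ, c ⬝ᵥ M *ᵥ e = ∫ x in D, (c ⬝ᵥ x) * (e ⬝ᵥ x) := by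
    intro c e
    have : ∀ x : Fin K → ℝ, (c ⬝ᵥ x) * (e ⬝ᵥ x) = ∑ i, ∑ j, c i * e j * (x i * x j) := by
      intro x
      simp only [dotProduct, Finset.sum_mul_sum]
      exact Finset.sum_congr rfl fun i _ => Finset.sum_congr rfl fun j _ => by ring
    simp_rw [this]
    rw [integral_finsetSum _ fun i _ => integrable_finsetSum _ fun j _ => (hint i j).const_mul _]
    simp_rw [dotProduct, mulVec, dotProduct, Finset.mul_sum]
    refine Finset.sum_congr rfl fun i _ => ?_
    rw [integral_finsetSum _ fun j _ => (hint i j).const_mul _]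
    refine Finset.sum_congr rfl fun j _ => ?_
    rw [integral_const_mul, hM, Matrix.of_apply]; ring
  have hMpd : M.PosDef := by
    refine Matrix.PosDef.of_dotProduct_mulVec_pos ?_ ?_
    · ext i j
      simp [hM, mul_comm]
    · intro c hc
      rw [star_trivial, hquad]
      simpa [sq] using setIntegral_dotProduct_sq_pos hDc hDi hc
  have hinv : ∀ T : (Fin K → ℝ) ≃L[ℝ] (Fin K → ℝ), T '' S = S →
      ∀ R : Matrix (Fin K) (Fin K) ℝ, (∀ v, T v = R *ᵥ v) → R * M * Rᵀ = M := by
    intro T hT R hR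
    have hmp := measurePreserving_of_image_eq hDc hDi T (hDT T hT)
    have key : ∀ c e : Fin K → ℝ, c ⬝ᵥ (R * M * Rᵀ) *ᵥ e = c ⬝ᵥ M *ᵥ e := by
      intro c e
      have h1 := hmp.setIntegral_preimage_emb T.toHomeomorph.measurableEmbedding
        (fun x => (c ⬝ᵥ x) * (e ⬝ᵥ x)) D
      have h2 : T ⁻¹' D = D := by
        conv_lhs => rw [← hDT T hT]
        exact Set.preimage_image_eq _ T.injective
      rw [h2, ← hquad] at h1
      rw [← h1, ← mulVec_mulVec, ← mulVec_mulVec, dotProduct_mulVec c R, hquad]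
      congr 1
      ext x
      rw [hR, dotProduct_mulVec, dotProduct_mulVec, mulVec_transpose]
    ext i j
    simpa using key (Pi.single i 1) (Pi.single j 1)
  obtain ⟨C, hCu, hC⟩ := hMpd.inv.exists_isUnit_transpose_mul_self
  have hMdet : IsUnit M.det := (Matrix.isUnit_iff_isUnit_det M).1 hMpd.isUnit
  refine ⟨(Matrix.toLinearEquiv' C hCu.invertible).trans (WithLp.linearEquiv 2 ℝ _).symm, ?_⟩
  intro T hT v w
  have hin : ∀ v w : Fin K → ℝ, inner ℝ
      (((Matrix.toLinearEquiv' C hCu.invertible).trans (WithLp.linearEquiv 2 ℝ _).symm) v)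
      (((Matrix.toLinearEquiv' C hCu.invertible).trans (WithLp.linearEquiv 2 ℝ _).symm) w)
      = v ⬝ᵥ M⁻¹ *ᵥ w := by
    intro v w
    rw [hC, ← mulVec_mulVec, dotProduct_mulVec, vecMul_transpose, dotProduct_comm]
    simp only [LinearEquiv.trans_apply, WithLp.linearEquiv_symm_apply,
      EuclideanSpace.inner_eq_star_dotProduct, star_trivial]
    rfl
  rw [hin, hin]
  set R : Matrix (Fin K) (Fin K) ℝ :=
    LinearMap.toMatrix' (T : (Fin K → ℝ) →ₗ[ℝ] (Fin K → ℝ))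
  have hR : ∀ v, T v = R *ᵥ v := fun v => by simp [R]
  have h1 := hinv T hT R hR
  have hRu : IsUnit R.det := by
    have h2 : IsUnit (R * M * Rᵀ).det := h1.symm ▸ hMdet
    rw [det_mul, det_mul] at h2
    exact isUnit_of_mul_isUnit_left (isUnit_of_mul_isUnit_left h2)
  have hRu' : IsUnit (Rᵀ).det := by rwa [det_transpose]
  have h2 : Rᵀ * M⁻¹ * R = M⁻¹ := by
    conv_lhs => rw [← h1, Matrix.mul_inv_rev, Matrix.mul_inv_rev]
    rw [← Matrix.mul_assoc, ← Matrix.mul_assoc, Matrix.mul_nonsing_inv _ hRu', Matrix.one_mul,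
      Matrix.mul_assoc, Matrix.nonsing_inv_mul _ hRu, Matrix.mul_one]
  conv_rhs => rw [← h2, ← mulVec_mulVec, ← mulVec_mulVec, dotProduct_mulVec v, vecMul_transpose]
  rw [hR, hR]

end

namespace GPT

/-! ### States and invariant states of a system -/

namespace System

variable {A : System}

/-- The group of reversible transformations acts transitively on the pure states. -/
def IsSymmetric (A : System) : Prop :=
  ∀ ω ∈ A.pureStates, ∀ φ ∈ A.pureStates, ∃ T ∈ A.G, T ω = φ

/-- A state fixed by all reversible transformations (a maximally mixed state). -/
def IsInvariantState (A : System) (μ : A.V) : Prop :=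
  μ ∈ A.states ∧ ∀ T ∈ A.G, T μ = μ

theorem apply_mem_states {T : A.V ≃L[ℝ] A.V} (hT : T ∈ A.G) {ω : A.V} (hω : ω ∈ A.states) :
    T ω ∈ A.states := A.G_states T hT ▸ Set.mem_image_of_mem T hω

theorem linearMap_ext_states {M : Type*} [AddCommGroup M] [Module ℝ M] {f g : A.V →ₗ[ℝ] M}
    (h : ∀ ω ∈ A.states, f ω = g ω) : f = g :=
  LinearMap.ext_on A.states_span h

theorem unit_apply_of_mem_G {T : A.V ≃L[ℝ] A.V} (hT : T ∈ A.G) (v : A.V) :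
    A.unit (T v) = A.unit v := by
  have : (A.unit : A.V →ₗ[ℝ] ℝ) ∘ₗ (T.toLinearEquiv : A.V →ₗ[ℝ] A.V) = (A.unit : A.V →ₗ[ℝ] ℝ) :=
    linearMap_ext_states fun ω hω => by
      simp [A.states_normalized _ (apply_mem_states hT hω), A.states_normalized _ hω]
  exact LinearMap.congr_fun this v

/-- The states generate the vector space as the difference of the cone that they span. -/
theorem exists_eq_smul_sub_smul (v : A.V) : ∃ s t : ℝ, 0 ≤ s ∧ 0 ≤ t ∧
    ∃ ω ∈ A.states, ∃ φ ∈ A.states, v = s • ω - t • φ := by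
  have cone : ∀ s₁ s₂ : ℝ, 0 ≤ s₁ → 0 ≤ s₂ → ∀ ω₁ ∈ A.states, ∀ ω₂ ∈ A.states,
      ∃ ω ∈ A.states, s₁ • ω₁ + s₂ • ω₂ = (s₁ + s₂) • ω := by
    intro s₁ s₂ h₁ h₂ ω₁ hω₁ ω₂ hω₂
    rcases (add_nonneg h₁ h₂).eq_or_lt with h | h
    · have e1 : s₁ = 0 := by linarith
      have e2 : s₂ = 0 := by linarith
      exact ⟨ω₁, hω₁, by simp [e1, e2]⟩
    · refine ⟨(s₁ / (s₁ + s₂)) • ω₁ + (s₂ / (s₁ + s₂)) • ω₂,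
        A.states_convex hω₁ hω₂ (by positivity) (by positivity) (by field_simp), ?_⟩
      rw [smul_add, smul_smul, smul_smul, mul_div_cancel₀ _ h.ne', mul_div_cancel₀ _ h.ne']
  have hv : v ∈ Submodule.span ℝ A.states := A.states_span ▸ Submodule.mem_top
  induction hv using Submodule.span_induction with
  | mem x hx => exact ⟨1, 0, zero_le_one, le_rfl, x, hx, x, hx, by simp⟩
  | zero =>
    obtain ⟨x, hx⟩ := A.states_nonempty
    exact ⟨0, 0, le_rfl, le_rfl, x, hx, x, hx, by simp⟩
  | add x y _ _ hx hy =>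
    obtain ⟨s, t, hs, ht, ω, hω, φ, hφ, rfl⟩ := hx
    obtain ⟨s', t', hs', ht', ω', hω', φ', hφ', rfl⟩ := hy
    obtain ⟨ρ, hρ, e1⟩ := cone s s' hs hs' ω hω ω' hω'
    obtain ⟨σ, hσ, e2⟩ := cone t t' ht ht' φ hφ φ' hφ'
    refine ⟨s + s', t + t', by positivity, by positivity, ρ, hρ, σ, hσ, ?_⟩
    rw [← e1, ← e2]; abel
  | smul c x _ hx =>
    obtain ⟨s, t, hs, ht, ω, hω, φ, hφ, rfl⟩ := hx
    rcases le_total 0 c with hc | hc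
    · exact ⟨c * s, c * t, by positivity, by positivity, ω, hω, φ, hφ, by
        rw [smul_sub, smul_smul, smul_smul]⟩
    · refine ⟨-c * t, -c * s, mul_nonneg (by linarith) ht, mul_nonneg (by linarith) hs,
        φ, hφ, ω, hω, ?_⟩
      rw [smul_sub, smul_smul, smul_smul, neg_mul, neg_mul, neg_smul, neg_smul]; abel

/-- Functionals that include the unit and separate the states separate all vectors. -/
theorem eq_zero_of_separating {F : Set (A.V →L[ℝ] ℝ)} (hu : A.unit ∈ F)
    (hF : ∀ ω ∈ A.states, ∀ φ ∈ A.states, (∀ f ∈ F, f ω = f φ) → ω = φ) {v : A.V}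
    (hv : ∀ f ∈ F, f v = 0) : v = 0 := by
  obtain ⟨s, t, hs, ht, ω, hω, φ, hφ, rfl⟩ := A.exists_eq_smul_sub_smul v
  have hst : s = t := by
    have := hv _ hu
    simp only [map_sub, map_smul, A.states_normalized _ hω, A.states_normalized _ hφ,
      smul_eq_mul, mul_one] at this
    linarith
  subst hst
  rcases eq_or_ne s 0 with rfl | h0
  · simp
  have : ω = φ := hF ω hω φ hφ fun f hf => by
    have := hv f hf
    rw [← smul_sub, map_smul, smul_eq_mul, map_sub] at this
    have := (mul_eq_zero.1 this).resolve_left h0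
    linarith
  rw [this, sub_self]

theorem eq_of_effects_eq {ω φ : A.V} (h : ∀ E ∈ A.effects, E ω = E φ) : ω = φ :=
  sub_eq_zero.1 <| eq_zero_of_separating A.unit_mem A.effects_separate fun E hE => by
    rw [map_sub, h E hE, sub_self]

/-- A closed convex set that contains the pure states contains all states (Krein–Milman). -/
theorem states_subset_of_pureStates_subset {C : Set A.V} (hc : IsClosed C) (hconv : Convex ℝ C)
    (h : A.pureStates ⊆ C) : A.states ⊆ C := by
  rw [← closure_convexHull_extremePoints A.states_compact A.states_convex]
  exact closure_minimal (convexHull_min h hconv) hc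

/-- A linear functional attains its maximum over the states at a pure state. -/
theorem exists_mem_pureStates_apply_eq (E : A.V →L[ℝ] ℝ) {ω : A.V} (hω : ω ∈ A.states)
    (hmax : ∀ φ ∈ A.states, E φ ≤ E ω) : ∃ φ ∈ A.pureStates, E φ = E ω := by
  set F : Set A.V := {φ ∈ A.states | ∀ ψ ∈ A.states, E ψ ≤ E φ}
  have hF : IsExposed ℝ A.states F := fun _ => ⟨E, rfl⟩
  obtain ⟨φ, hφ⟩ := (hF.isCompact A.states_compact).extremePoints_nonempty ⟨ω, hω, hmax⟩
  exact ⟨φ, hF.isExtreme.extremePoints_subset_extremePoints hφ,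
    le_antisymm (hmax φ hφ.1.1) (hφ.1.2 ω hω)⟩

theorem pureStates_nonempty : A.pureStates.Nonempty :=
  A.states_compact.extremePoints_nonempty A.states_nonempty

theorem exists_euclidean (A : System) :
    ∃ Q : A.V ≃ₗ[ℝ] EuclideanSpace ℝ (Fin A.K),
      ∀ T ∈ A.G, ∀ v w, inner ℝ (Q (T v)) (Q (T w)) = inner ℝ (Q v) (Q w) := by
  obtain ⟨Q, hQ⟩ := exists_euclidean_of_isCompact_span A.states_compact A.states_span
  exact ⟨Q, fun T hT => hQ T (A.G_states T hT)⟩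

/-- The state of least norm in an invariant Euclidean structure is invariant. -/
theorem exists_isInvariantState (A : System) : ∃ μ, A.IsInvariantState μ := by
  obtain ⟨Q, hQ⟩ := A.exists_euclidean
  have hcont : Continuous Q := Q.toLinearMap.continuous_of_finiteDimensional
  obtain ⟨μ, hμ, hmin⟩ := A.states_compact.exists_isMinOn A.states_nonempty
    (f := fun v => ‖Q v‖) hcont.norm.continuousOn
  refine ⟨μ, hμ, fun T hT => ?_⟩
  have hTμ := apply_mem_states hT hμ
  have hnorm : ‖Q (T μ)‖ = ‖Q μ‖ := by
    rw [← sq_eq_sq₀ (norm_nonneg _) (norm_nonneg _), ← real_inner_self_eq_norm_sq,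
      ← real_inner_self_eq_norm_sq, hQ T hT]
  have hmid : (1 / 2 : ℝ) • T μ + (1 / 2 : ℝ) • μ ∈ A.states :=
    A.states_convex hTμ hμ (by norm_num) (by norm_num) (by norm_num)
  have h1 : ‖Q μ‖ ≤ ‖Q ((1 / 2 : ℝ) • T μ + (1 / 2 : ℝ) • μ)‖ := hmin hmid
  rw [map_add, map_smul, map_smul, ← smul_add, norm_smul] at h1
  have h2 : 2 * ‖Q μ‖ ≤ ‖Q (T μ) + Q μ‖ := by
    rw [Real.norm_of_nonneg (by norm_num)] at h1; linarith
  have h3 := parallelogram_law_with_norm ℝ (Q (T μ)) (Q μ)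
  rw [hnorm] at h3
  have h4 : ‖Q (T μ) - Q μ‖ = 0 := by
    nlinarith [norm_nonneg (Q (T μ) - Q μ), norm_nonneg (Q μ), norm_nonneg (Q (T μ) + Q μ)]
  exact Q.injective (sub_eq_zero.1 (norm_eq_zero.1 h4))

theorem IsSymmetric.isInvariantState_unique (hA : A.IsSymmetric) {μ ν : A.V}
    (hμ : A.IsInvariantState μ) (hν : A.IsInvariantState ν) : μ = ν := by
  obtain ⟨Q, hQ⟩ := A.exists_euclidean
  obtain ⟨ω, hω⟩ := A.pureStates_nonempty
  have hcont : Continuous Q := Q.toLinearMap.continuous_of_finiteDimensional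
  set c := inner ℝ (Q ω) (Q (μ - ν))
  have hconst : A.states ⊆ {φ | inner ℝ (Q φ) (Q (μ - ν)) = c} := by
    refine states_subset_of_pureStates_subset
      (isClosed_eq (hcont.inner continuous_const) continuous_const) ?_ ?_
    · intro x hx y hy a b _ _ hab
      simp only [Set.mem_ofPred_eq] at hx hy ⊢
      rw [map_add, map_smul, map_smul, inner_add_left, real_inner_smul_left, real_inner_smul_left,
        hx, hy, ← add_mul, hab, one_mul]
    · intro φ hφ
      obtain ⟨T, hT, rfl⟩ := hA ω hω φ hφ
      have : T (μ - ν) = μ - ν := by rw [map_sub, hμ.2 T hT, hν.2 T hT]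
      change inner ℝ (Q (T ω)) (Q (μ - ν)) = c
      have h := hQ T hT ω (μ - ν)
      rwa [this] at h
  have h : inner ℝ (Q (μ - ν)) (Q (μ - ν)) = (0 : ℝ) := by
    conv_lhs => rw [map_sub Q, inner_sub_left]
    rw [← map_sub, hconst hμ.1, hconst hν.1, sub_self]
  exact sub_eq_zero.1 (Q.map_eq_zero_iff.1 (inner_self_eq_zero.1 h))

end System

/-! ### Locally tomographic composites -/

namespace Composite

variable {A B AB : System} (C : Composite A B AB)

theorem eff_le_eff_unit_left {E : A.V →L[ℝ] ℝ} (hE : E ∈ A.effects) {F : B.V →L[ℝ] ℝ}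
    (hF : F ∈ B.effects) {ω : AB.V} (hω : ω ∈ AB.states) : C.eff E F ω ≤ C.eff A.unit F ω := by
  have := (AB.effects_prob _ (C.eff_mem _ (A.compl_mem E hE) F hF) ω hω).1
  rw [map_sub, LinearMap.sub_apply, sub_apply] at this
  linarith

theorem eff_nonneg {E : A.V →L[ℝ] ℝ} (hE : E ∈ A.effects) {F : B.V →L[ℝ] ℝ}
    (hF : F ∈ B.effects) {ω : AB.V} (hω : ω ∈ AB.states) : 0 ≤ C.eff E F ω :=
  (AB.effects_prob _ (C.eff_mem _ hE F hF) ω hω).1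

theorem exists_marginal_left {ω : AB.V} (hω : ω ∈ AB.states) :
    ∃ a ∈ A.states, ∀ E ∈ A.effects, E a = C.eff E B.unit ω := by
  have h1 : C.eff A.unit B.unit ω = 1 := by rw [C.eff_unit, AB.states_normalized _ hω]
  obtain ⟨a, ha, h⟩ := C.cond_left ω hω B.unit B.unit_mem (by rw [h1]; exact one_ne_zero)
  exact ⟨a, ha, fun E hE => by rw [h E hE, h1, div_one]⟩

theorem exists_marginal_right {ω : AB.V} (hω : ω ∈ AB.states) :
    ∃ b ∈ B.states, ∀ F ∈ B.effects, F b = C.eff A.unit F ω := by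
  have h1 : C.eff A.unit B.unit ω = 1 := by rw [C.eff_unit, AB.states_normalized _ hω]
  obtain ⟨b, hb, h⟩ := C.cond_right ω hω A.unit A.unit_mem (by rw [h1]; exact one_ne_zero)
  exact ⟨b, hb, fun F hF => by rw [h F hF, h1, div_one]⟩

/-- A state of a composite with a pure marginal is uncorrelated: the pure marginal is a mixture of
the two states conditional on `F` and on `𝟏 - F`, so both of them equal it. -/
theorem eff_eq_mul_of_pure_marginal {ω : AB.V} (hω : ω ∈ AB.states) {a : A.V}
    (ha : a ∈ A.pureStates) (hm : ∀ E ∈ A.effects, E a = C.eff E B.unit ω)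
    {E : A.V →L[ℝ] ℝ} (hE : E ∈ A.effects) {F : B.V →L[ℝ] ℝ} (hF : F ∈ B.effects) :
    C.eff E F ω = E a * C.eff A.unit F ω := by
  have hsplit : ∀ E : A.V →L[ℝ] ℝ, C.eff E (B.unit - F) ω = C.eff E B.unit ω - C.eff E F ω := by
    intro E
    rw [map_sub, sub_apply]
  have h1 : C.eff A.unit B.unit ω = 1 := by rw [C.eff_unit, AB.states_normalized _ hω]
  set p := C.eff A.unit F ω with hp
  have hp0 : 0 ≤ p := C.eff_nonneg A.unit_mem hF hω
  have hq : C.eff A.unit (B.unit - F) ω = 1 - p := by rw [hsplit, h1]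
  have hq0 : 0 ≤ 1 - p := hq ▸ C.eff_nonneg A.unit_mem (B.compl_mem F hF) hω
  have hz : ∀ F' ∈ B.effects, C.eff A.unit F' ω = 0 → ∀ E ∈ A.effects, C.eff E F' ω = 0 :=
    fun F' hF' h0 E hE =>
      le_antisymm (h0 ▸ C.eff_le_eff_unit_left hE hF' hω) (C.eff_nonneg hE hF' hω)
  rcases hp0.eq_or_lt with hp' | hp'
  · rw [hz F hF hp'.symm E hE, ← hp', mul_zero]
  rcases hq0.eq_or_lt with hq' | hq'
  · have := hz _ (B.compl_mem F hF) (hq.trans hq'.symm) E hE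
    rw [hsplit, ← hm E hE] at this
    rw [show p = 1 by linarith, mul_one]; linarith
  obtain ⟨x, hx, hxE⟩ := C.cond_left ω hω F hF hp'.ne'
  obtain ⟨y, hy, hyE⟩ := C.cond_left ω hω _ (B.compl_mem F hF) (by rw [hq]; exact hq'.ne')
  have hmix : p • x + (1 - p) • y = a := by
    refine System.eq_of_effects_eq fun E hE => ?_
    rw [map_add, map_smul, map_smul, smul_eq_mul, smul_eq_mul, hxE E hE, hyE E hE, hq, hsplit,
      ← hm E hE, mul_div_cancel₀ _ hp'.ne', mul_div_cancel₀ _ hq'.ne']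
    ring
  have hxa : x = a := ha.2 hx hy ⟨p, 1 - p, hp', hq', by ring, hmix⟩
  rw [← hxa, hxE E hE, div_mul_cancel₀ _ hp'.ne']

/-- In a locally tomographic composite, products of pure states are pure. -/
theorem st_mem_pureStates (hC : C.LocallyTomographic) {a : A.V} (ha : a ∈ A.pureStates) {b : B.V}
    (hb : b ∈ B.pureStates) : C.st a b ∈ AB.pureStates := by
  refine ⟨C.st_mem a ha.1 b hb.1, ?_⟩
  rintro ω hω φ hφ ⟨s, t, hs, ht, hst, hmix⟩
  obtain ⟨x, hx, hxE⟩ := C.exists_marginal_left hω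
  obtain ⟨x', hx', hxE'⟩ := C.exists_marginal_left hφ
  obtain ⟨y, hy, hyE⟩ := C.exists_marginal_right hω
  obtain ⟨y', hy', hyE'⟩ := C.exists_marginal_right hφ
  have ha1 : A.unit a = 1 := A.states_normalized _ ha.1
  have hb1 : B.unit b = 1 := B.states_normalized _ hb.1
  have hxa : x = a := ha.2 hx hx' ⟨s, t, hs, ht, hst, System.eq_of_effects_eq fun E hE => by
    have := congrArg (C.eff E B.unit) hmix
    rw [C.eff_st, hb1, mul_one, map_add, map_smul, map_smul, ← hxE E hE, ← hxE' E hE] at this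
    rw [map_add, map_smul, map_smul, this]⟩
  have hyb : y = b := hb.2 hy hy' ⟨s, t, hs, ht, hst, System.eq_of_effects_eq fun F hF => by
    have := congrArg (C.eff A.unit F) hmix
    rw [C.eff_st, ha1, one_mul, map_add, map_smul, map_smul, ← hyE F hF, ← hyE' F hF] at this
    rw [map_add, map_smul, map_smul, this]⟩
  subst hxa hyb
  refine hC _ hω _ (C.st_mem _ hx _ hy) fun E hE F hF => ?_
  rw [C.eff_eq_mul_of_pure_marginal hω ha hxE hE hF, C.eff_st, hyE F hF]

/-- The conditional states of an invariant state are invariant, hence the maximally mixed state of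
a composite is the product of those of its parts. -/
theorem eq_st_of_isInvariantState (hC : C.LocallyTomographic) (hA : A.IsSymmetric)
    (hB : B.IsSymmetric) {μA : A.V} (hμA : A.IsInvariantState μA) {μB : B.V}
    (hμB : B.IsInvariantState μB) {μ : AB.V} (hμ : AB.IsInvariantState μ) : μ = C.st μA μB := by
  have hfixA : ∀ S ∈ A.G, ∀ E F, C.eff (E.comp (S : A.V →L[ℝ] A.V)) F μ = C.eff E F μ := by
    intro S hS E F
    obtain ⟨R, hR, -, h⟩ := C.local_trans S hS 1 (one_mem _)
    have := h E F μ
    rw [hμ.2 R hR] at this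
    exact this.symm
  have hfixB : ∀ T ∈ B.G, ∀ E F, C.eff E (F.comp (T : B.V →L[ℝ] B.V)) μ = C.eff E F μ := by
    intro T hT E F
    obtain ⟨R, hR, -, h⟩ := C.local_trans 1 (one_mem _) T hT
    have := h E F μ
    rw [hμ.2 R hR] at this
    exact this.symm
  refine hC _ hμ.1 _ (C.st_mem _ hμA.1 _ hμB.1) fun E hE F hF => ?_
  rw [C.eff_st]
  obtain ⟨b, hb, hbF⟩ := C.exists_marginal_right hμ.1
  have hbμ : b = μB := hB.isInvariantState_unique ⟨hb, fun T hT => System.eq_of_effects_eq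
    fun F hF => by
      have := hbF _ (B.G_effects T hT F hF)
      rw [hfixB T hT, ← hbF F hF] at this
      exact this⟩ hμB
  rw [← hbμ, hbF F hF]
  by_cases h0 : C.eff A.unit F μ = 0
  · rw [h0, mul_zero]
    exact le_antisymm (h0 ▸ C.eff_le_eff_unit_left hE hF hμ.1) (C.eff_nonneg hE hF hμ.1)
  obtain ⟨a, ha, haE⟩ := C.cond_left μ hμ.1 F hF h0
  have haμ : a = μA := hA.isInvariantState_unique ⟨ha, fun S hS => System.eq_of_effects_eq
    fun E hE => by
      have := haE _ (A.G_effects S hS E hE)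
      rw [hfixA S hS, ← haE E hE] at this
      exact this⟩ hμA
  rw [← haμ, haE E hE, div_mul_cancel₀ _ h0]

/-- Local tomography identifies the space of the composite with the tensor product: linear
coordinates on the parts give coordinates on the composite, in which product vectors have the
products of the coordinates. -/
theorem exists_coordinates (hC : C.LocallyTomographic) {m n : ℕ}
    (LA : A.V ≃ₗ[ℝ] (Fin m → ℝ)) (LB : B.V ≃ₗ[ℝ] (Fin n → ℝ)) :
    ∃ Φ : AB.V ≃ₗ[ℝ] (Fin m × Fin n → ℝ), ∀ a b i j, Φ (C.st a b) (i, j) = LA a i * LB b j := by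
  set e : Fin m → (A.V →L[ℝ] ℝ) := fun i =>
    LinearMap.toContinuousLinearMap (LinearMap.proj i ∘ₗ LA.toLinearMap) with he
  set f : Fin n → (B.V →L[ℝ] ℝ) := fun j =>
    LinearMap.toContinuousLinearMap (LinearMap.proj j ∘ₗ LB.toLinearMap) with hf
  have he' : ∀ E : A.V →L[ℝ] ℝ, E = ∑ i, E (LA.symm (Pi.single i 1)) • e i := by
    intro E
    ext1 v
    obtain ⟨x, rfl⟩ := LA.symm.surjective v
    conv_lhs => rw [pi_eq_sum_univ' x, map_sum, map_sum]
    simp [he, mul_comm]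
  have hf' : ∀ F : B.V →L[ℝ] ℝ, F = ∑ j, F (LB.symm (Pi.single j 1)) • f j := by
    intro F
    ext1 v
    obtain ⟨x, rfl⟩ := LB.symm.surjective v
    conv_lhs => rw [pi_eq_sum_univ' x, map_sum, map_sum]
    simp [hf, mul_comm]
  set Ψ : AB.V →ₗ[ℝ] (Fin m × Fin n → ℝ) :=
    LinearMap.pi fun p => (C.eff (e p.1) (f p.2) : AB.V →ₗ[ℝ] ℝ) with hΨ
  have hst : ∀ a b i j, Ψ (C.st a b) (i, j) = LA a i * LB b j := fun a b i j => by
    simp [hΨ, C.eff_st, he, hf]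
  have hinj : Function.Injective Ψ := by
    rw [injective_iff_map_eq_zero]
    intro v hv
    have hz : ∀ E F, C.eff E F v = 0 := by
      intro E F
      rw [he' E, hf' F]
      simp only [map_sum, map_smul, LinearMap.sum_apply, LinearMap.smul_apply,
        sum_apply, smul_apply]
      refine Finset.sum_eq_zero fun j _ => ?_
      refine smul_eq_zero_of_right _ (Finset.sum_eq_zero fun i _ => smul_eq_zero_of_right _ ?_)
      exact congrFun hv (i, j)
    refine System.eq_zero_of_separating
      (F := {G | ∃ E ∈ A.effects, ∃ F ∈ B.effects, G = C.eff E F})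
      ⟨_, A.unit_mem, _, B.unit_mem, C.eff_unit.symm⟩ (fun ω hω φ hφ h => ?_) ?_
    · exact hC ω hω φ hφ fun E hE F hF => h _ ⟨E, hE, F, hF, rfl⟩
    · rintro _ ⟨E, -, F, -, rfl⟩
      exact hz E F
  have hsurj : Function.Surjective Ψ := by
    intro x
    refine ⟨∑ k, ∑ l, x (k, l) • C.st (LA.symm (Pi.single k 1)) (LB.symm (Pi.single l 1)), ?_⟩
    ext ⟨i, j⟩
    simp only [map_sum, map_smul, Finset.sum_apply, Pi.smul_apply, hst,
      LinearEquiv.apply_symm_apply, Pi.single_apply, smul_eq_mul]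
    simp
  exact ⟨LinearEquiv.ofBijective Ψ ⟨hinj, hsurj⟩, hst⟩

theorem K_eq_mul (hC : C.LocallyTomographic) : AB.K = A.K * B.K := by
  obtain ⟨Φ, -⟩ := C.exists_coordinates hC (LinearEquiv.refl ℝ A.V) (LinearEquiv.refl ℝ B.V)
  simpa using Φ.finrank_eq

end Composite

/-! ### Distinguishing measurements and faces -/

namespace System

variable {A B : System}

theorem HasCapacity.unique {M N : ℕ} (hM : A.HasCapacity M) (hN : A.HasCapacity N) : M = N :=
  IsGreatest.unique hM hN

namespace Distinguishes

variable {n : ℕ} {E : Fin n → (A.V →L[ℝ] ℝ)} {ω : Fin n → A.V}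

theorem sum_apply (h : A.Distinguishes E ω) {φ : A.V} (hφ : φ ∈ A.states) : ∑ i, E i φ = 1 := by
  rw [← A.states_normalized φ hφ, ← h.1.2, _root_.sum_apply]

theorem apply_self (h : A.Distinguishes E ω) (i : Fin n) : E i (ω i) = 1 := by
  rw [h.2.2, if_pos rfl]

theorem apply_of_ne (h : A.Distinguishes E ω) {i j : Fin n} (hij : i ≠ j) : E i (ω j) = 0 := by
  rw [h.2.2, if_neg hij]

theorem apply_eq_zero_of_apply_eq_one (h : A.Distinguishes E ω) {φ : A.V} (hφ : φ ∈ A.states)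
    {i j : Fin n} (hij : i ≠ j) (hi : E i φ = 1) : E j φ = 0 := by
  have h0 : ∀ k, 0 ≤ E k φ := fun k => (A.effects_prob _ (h.1.1 k) φ hφ).1
  have h1 := h.sum_apply hφ
  rw [← Finset.add_sum_erase _ _ (Finset.mem_univ i), hi] at h1
  have h2 : ∑ k ∈ Finset.univ.erase i, E k φ = 0 := by linarith
  exact (Finset.sum_eq_zero_iff_of_nonneg fun k _ => h0 k).1 h2 j
    (Finset.mem_erase.2 ⟨hij.symm, Finset.mem_univ j⟩)

theorem comp_perm (h : A.Distinguishes E ω) (σ : Equiv.Perm (Fin n)) :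
    A.Distinguishes (E ∘ σ) (ω ∘ σ) := by
  refine ⟨⟨fun i => h.1.1 _, ?_⟩, fun j => h.2.1 _, fun i j => ?_⟩
  · rw [← h.1.2]
    exact Equiv.sum_comp σ E
  · simp [h.2.2, σ.injective.eq_iff]

theorem mem_zeroFace (h : A.Distinguishes E ω) {i j : Fin n} (hij : i ≠ j) :
    ω j ∈ A.zeroFace (E i) := ⟨h.2.1 j, h.apply_of_ne hij⟩

end Distinguishes

/-- The inclusion `ι` of `B` as the face `{ω | E ω = 0}` of `A`: the states of `B` are the states in
the face, effects of `A` restrict to effects of `B`, and reversible transformations of `B` extend to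
reversible transformations of `A` that preserve the face. -/
structure IsFaceEmbedding (A : System) (E : A.V →L[ℝ] ℝ) (B : System) (ι : B.V →ₗ[ℝ] A.V) :
    Prop where
  injective : Function.Injective ι
  image_states : ι '' B.states = A.zeroFace E
  exists_effect : ∀ E' ∈ A.effects, ∃ F ∈ B.effects, ∀ v, F v = E' (ι v)
  exists_extension : ∀ U ∈ B.G, ∃ T ∈ A.G, T '' A.zeroFace E = A.zeroFace E ∧
    ∀ v, T (ι v) = ι (U v)

theorem ZeroFaceEquivalent.exists_isFaceEmbedding {E : A.V →L[ℝ] ℝ}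
    (h : A.ZeroFaceEquivalent E B) : ∃ ι, A.IsFaceEmbedding E B ι := by
  obtain ⟨L, h1, h2, h3⟩ := h
  refine ⟨Submodule.subtype _ ∘ₗ L.toLinearMap,
    Subtype.val_injective.comp L.injective, h1, fun E' hE' => ?_, fun U hU => (h3 U).1 hU⟩
  refine ⟨E'.comp (LinearMap.toContinuousLinearMap (Submodule.subtype _ ∘ₗ L.toLinearMap)),
    (h2 _).2 ⟨E', hE', fun v => rfl⟩, fun v => rfl⟩

namespace IsFaceEmbedding

variable {ι : B.V →ₗ[ℝ] A.V}

theorem range_eq_span {E : A.V →L[ℝ] ℝ} (h : A.IsFaceEmbedding E B ι) :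
    LinearMap.range ι = Submodule.span ℝ (A.zeroFace E) := by
  rw [← h.image_states, Submodule.span_image, B.states_span, LinearMap.range_eq_map]

theorem K_eq_finrank {E : A.V →L[ℝ] ℝ} (h : A.IsFaceEmbedding E B ι) :
    B.K = Module.finrank ℝ (Submodule.span ℝ (A.zeroFace E)) := by
  rw [← h.range_eq_span, LinearMap.finrank_range_of_inj h.injective]
  simp

theorem apply_mem {E : A.V →L[ℝ] ℝ} (h : A.IsFaceEmbedding E B ι) {v : B.V} (hv : v ∈ B.states) :
    ι v ∈ A.zeroFace E := h.image_states ▸ Set.mem_image_of_mem ι hv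

variable {N : ℕ} {E : Fin (N + 1) → (A.V →L[ℝ] ℝ)} {ω : Fin (N + 1) → A.V}

/-- Leaving out the last outcome and the last state of a distinguishing measurement gives a
distinguishing measurement on the face of the last outcome. -/
theorem exists_distinguishes (h : A.IsFaceEmbedding (E (Fin.last N)) B ι)
    (hE : A.Distinguishes E ω) : ∃ (F : Fin N → (B.V →L[ℝ] ℝ)) (φ : Fin N → B.V),
      B.Distinguishes F φ ∧ (∀ k v, F k v = E k.castSucc (ι v)) ∧
      ∀ k, ι (φ k) = ω k.castSucc := by
  choose F hF hFE using fun k : Fin N => h.exists_effect _ (hE.1.1 k.castSucc)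
  have hmem : ∀ k : Fin N, ω k.castSucc ∈ ι '' B.states := fun k => by
    rw [h.image_states]
    exact hE.mem_zeroFace (Fin.castSucc_lt_last k).ne'
  choose φ hφ hφω using hmem
  refine ⟨F, φ, ⟨⟨hF, ?_⟩, hφ, fun i j => ?_⟩, hFE, hφω⟩
  · have : ((∑ i, F i : B.V →L[ℝ] ℝ) : B.V →ₗ[ℝ] ℝ) = (B.unit : B.V →ₗ[ℝ] ℝ) :=
      linearMap_ext_states fun v hv => by
        have h1 := hE.sum_apply (h.apply_mem hv).1
        rw [Fin.sum_univ_castSucc, (h.apply_mem hv).2, add_zero] at h1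
        change (∑ i, F i) v = B.unit v
        rw [_root_.sum_apply, B.states_normalized v hv, ← h1]
        exact Finset.sum_congr rfl fun i _ => hFE i v
    ext1 v
    exact LinearMap.congr_fun this v
  · rw [hFE, hφω, hE.2.2]
    simp

end IsFaceEmbedding

/-- If the maximally mixed state is the uniform mixture of pure states `φ i`, then an effect that is
certain on some state has at least the probability `1 / N` on the maximally mixed state: move one of
the `φ i` to a pure state on which the effect is certain. -/
theorem IsSymmetric.one_le_mul_apply (hA : A.IsSymmetric) {ι : Type*} [Fintype ι] [Nonempty ι]
    {φ : ι → A.V} (hφ : ∀ i, φ i ∈ A.pureStates) {μ : A.V} (hμ : A.IsInvariantState μ)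
    (hsum : ∑ i, φ i = (Fintype.card ι : ℝ) • μ) {E : A.V →L[ℝ] ℝ} (hE : E ∈ A.effects)
    {ω : A.V} (hω : ω ∈ A.states) (h1 : E ω = 1) : 1 ≤ Fintype.card ι * E μ := by
  obtain ⟨ψ, hψ, hψ1⟩ := A.exists_mem_pureStates_apply_eq E hω fun x hx => by
    rw [h1]; exact (A.effects_prob E hE x hx).2
  obtain ⟨i₀⟩ := ‹Nonempty ι›
  obtain ⟨T, hT, hTψ⟩ := hA _ (hφ i₀) ψ hψ
  have h2 := congrArg (fun v => E (T v)) hsum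
  simp only [map_sum, map_smul, hμ.2 T hT, smul_eq_mul] at h2
  rw [← h2, ← h1, ← hψ1, ← hTψ]
  exact Finset.single_le_sum (f := fun i => E (T (φ i)))
    (fun i _ => (A.effects_prob E hE _ (apply_mem_states hT (hφ i).1)).1) (Finset.mem_univ i₀)

/-- The maximally mixed state of `A` is the uniform mixture of `N` distinguishable states, where
`N` is the capacity of `A`. -/
def HasMixingBasis (A : System) (N : ℕ) : Prop :=
  A.HasCapacity N ∧ ∃ (E : Fin N → (A.V →L[ℝ] ℝ)) (ω : Fin N → A.V) (μ : A.V),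
    A.Distinguishes E ω ∧ A.IsInvariantState μ ∧ ∑ i, ω i = (N : ℝ) • μ

theorem HasCapacity.one_le {N : ℕ} (h : A.HasCapacity N) : 1 ≤ N := by
  obtain ⟨ω, hω⟩ := A.states_nonempty
  exact h.2 ⟨fun _ => A.unit, fun _ => ω, ⟨fun _ => A.unit_mem, by simp⟩, fun _ => hω,
    fun i j => by simp [Subsingleton.elim i j, A.states_normalized ω hω]⟩

/-- On a bit on which all effects are allowed, a nonconstant functional gives a complete measurement
whose last effect vanishes exactly where the functional is maximal on the states. -/
theorem exists_isCompleteMeasurement_zeroFace_eq (hA : A.HasCapacity 2)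
    (hall : ∀ E : A.V →L[ℝ] ℝ, (∀ ω ∈ A.states, 0 ≤ E ω ∧ E ω ≤ 1) → E ∈ A.effects)
    (f : A.V →L[ℝ] ℝ) {y : A.V} (hy : y ∈ A.states) (hmax : ∀ x ∈ A.states, f x ≤ f y)
    (hnc : ∃ z ∈ A.states, f z < f y) :
    ∃ E : Fin (1 + 1) → (A.V →L[ℝ] ℝ), A.IsCompleteMeasurement E ∧
      A.zeroFace (E (Fin.last 1)) = {x ∈ A.states | f x = f y} := by
  obtain ⟨z, hz, hmin⟩ := A.states_compact.exists_isMinOn A.states_nonempty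
    f.continuous.continuousOn
  have hzy : 0 < f y - f z := by
    obtain ⟨w, hw, hlt⟩ := hnc
    have : f z ≤ f w := hmin hw
    linarith
  set F : A.V →L[ℝ] ℝ := (f y - f z)⁻¹ • (f y • A.unit - f) with hF
  have hFx : ∀ x ∈ A.states, F x = (f y - f z)⁻¹ * (f y - f x) := fun x hx => by
    simp [hF, A.states_normalized x hx]
  have hFm : F ∈ A.effects := hall F fun x hx => by
    rw [hFx x hx]
    have h1 := hmax x hx
    have h2 : f z ≤ f x := hmin hx
    refine ⟨mul_nonneg (inv_nonneg.2 hzy.le) (by linarith), ?_⟩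
    rw [inv_mul_le_iff₀ hzy]; linarith
  have hFy : F y = 0 := by rw [hFx y hy, sub_self, mul_zero]
  have hFz : F z = 1 := by rw [hFx z hz, inv_mul_cancel₀ hzy.ne']
  refine ⟨![A.unit - F, F], ⟨hA, ![y, z], ⟨?_, ?_⟩, ?_, ?_⟩, ?_⟩
  · intro i
    fin_cases i
    exacts [A.compl_mem F hFm, hFm]
  · simp
  · intro j
    fin_cases j
    exacts [hy, hz]
  · intro i j
    fin_cases i <;> fin_cases j <;>
      simp [hFy, hFz, A.states_normalized y hy, A.states_normalized z hz]
  · ext x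
    change x ∈ A.states ∧ F x = 0 ↔ x ∈ A.states ∧ f x = f y
    refine and_congr_right fun hx => ?_
    rw [hFx x hx, mul_eq_zero, or_iff_right (inv_ne_zero hzy.ne'), sub_eq_zero, eq_comm]

theorem HasCapacity.exists_ne (hA : A.HasCapacity 2) :
    ∃ x ∈ A.states, ∃ y ∈ A.states, x ≠ y := by
  obtain ⟨E, ω, h⟩ := hA.1
  refine ⟨ω 0, h.2.1 0, ω 1, h.2.1 1, fun he => ?_⟩
  have := h.apply_self 0
  rw [he, h.apply_of_ne (by decide)] at this
  exact zero_ne_one this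

end System

/-! ### Capacity, faces and mixing bases in a theory -/

namespace Theory

variable {𝒯 : Theory}

theorem Postulates.isSymmetric (h : 𝒯.Postulates) (A : 𝒯.Sys) : (𝒯.sys A).IsSymmetric :=
  h.symmetry A

theorem Postulates.exists_isFaceEmbedding (h : 𝒯.Postulates) {A B : 𝒯.Sys} {N : ℕ}
    (hA : (𝒯.sys A).HasCapacity (N + 1)) (hB : (𝒯.sys B).HasCapacity N)
    {E : Fin (N + 1) → ((𝒯.sys A).V →L[ℝ] ℝ)} {ω : Fin (N + 1) → (𝒯.sys A).V}
    (hE : (𝒯.sys A).Distinguishes E ω) :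
    ∃ ι, (𝒯.sys A).IsFaceEmbedding (E (Fin.last N)) (𝒯.sys B) ι :=
  (h.subspaceEquivalence A B N hA hB E ⟨hA, ω, hE⟩).exists_isFaceEmbedding

/-- A system of capacity `1` has a single state, since it is equivalent to the face of a bit that
consists of an exposed point, namely of a state farthest from the origin. -/
theorem Postulates.subsingleton_states (h : 𝒯.Postulates) {B : 𝒯.Sys}
    (hB : (𝒯.sys B).HasCapacity 1) : (𝒯.sys B).states.Subsingleton := by
  obtain ⟨A, hA⟩ := 𝒯.exists_capacity 2 (by norm_num)
  obtain ⟨y, hy, hmax⟩ := (𝒯.sys A).states_compact.exists_isMaxOn (𝒯.sys A).states_nonempty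
    (f := fun x => x ⬝ᵥ x) (Continuous.continuousOn (by unfold dotProduct; fun_prop))
  have hexp : ∀ x ∈ (𝒯.sys A).states, y ⬝ᵥ x ≤ y ⬝ᵥ y ∧ (y ⬝ᵥ x = y ⬝ᵥ y → x = y) := by
    intro x hx
    have h1 : x ⬝ᵥ x ≤ y ⬝ᵥ y := hmax hx
    have h2 : (x - y) ⬝ᵥ (x - y) = x ⬝ᵥ x - 2 * (y ⬝ᵥ x) + y ⬝ᵥ y := by
      rw [sub_dotProduct, dotProduct_sub, dotProduct_sub, dotProduct_comm x y]; ring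
    have h3 : 0 ≤ (x - y) ⬝ᵥ (x - y) := Finset.sum_nonneg fun i _ => mul_self_nonneg _
    refine ⟨by linarith, fun h4 => ?_⟩
    have : (x - y) ⬝ᵥ (x - y) = 0 := by linarith
    exact sub_eq_zero.1 (dotProduct_self_eq_zero.1 this)
  set f : (𝒯.sys A).V →L[ℝ] ℝ := LinearMap.toContinuousLinearMap
    { toFun := fun x => y ⬝ᵥ x
      map_add' := fun a b => dotProduct_add y a b
      map_smul' := fun c a => dotProduct_smul c y a } with hf
  have hnc : ∃ z ∈ (𝒯.sys A).states, f z < f y := by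
    obtain ⟨u, hu, v, hv, huv⟩ := hA.exists_ne
    by_contra! hcon
    have e : ∀ z ∈ (𝒯.sys A).states, z = y := fun z hz =>
      (hexp z hz).2 (le_antisymm (hexp z hz).1 (hcon z hz))
    exact huv ((e u hu).trans (e v hv).symm)
  obtain ⟨E, hE, hface⟩ := System.exists_isCompleteMeasurement_zeroFace_eq hA
    (h.allBitEffectsAllowed A hA) f hy (fun x hx => (hexp x hx).1) hnc
  obtain ⟨ι, hι⟩ := (h.subspaceEquivalence A B 1 hA hB E hE).exists_isFaceEmbedding
  intro u hu v hv
  have e : ∀ w ∈ (𝒯.sys B).states, ι w = y := fun w hw => by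
    have := hι.apply_mem hw
    rw [hface] at this
    exact (hexp _ this.1).2 this.2
  exact hι.injective ((e u hu).trans (e v hv).symm)

/-- Each outcome of a complete measurement is certain on one state only: iterate the passage to
faces down to capacity `1`. -/
theorem Postulates.eq_of_apply_eq_one (h : 𝒯.Postulates) (N : ℕ) : ∀ {A : 𝒯.Sys},
    (𝒯.sys A).HasCapacity N → ∀ {E : Fin N → ((𝒯.sys A).V →L[ℝ] ℝ)} {ω : Fin N → (𝒯.sys A).V},
    (𝒯.sys A).Distinguishes E ω → ∀ (i : Fin N) {φ : (𝒯.sys A).V}, φ ∈ (𝒯.sys A).states →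
      E i φ = 1 → φ = ω i := by
  induction N with
  | zero => intro A _ E ω _ i; exact i.elim0
  | succ N ih =>
    intro A hA E ω hE i φ hφ hi
    rcases Nat.eq_zero_or_pos N with rfl | hN
    · exact h.subsingleton_states hA hφ (hE.2.1 i)
    obtain ⟨j, hj⟩ : ∃ j : Fin (N + 1), j ≠ i := by
      have : Nontrivial (Fin (N + 1)) := Fin.nontrivial_iff_two_le.2 (by omega)
      exact exists_ne i
    set σ := Equiv.swap j (Fin.last N) with hσ
    have hσj : σ (Fin.last N) = j := Equiv.swap_apply_right _ _
    have hE' := hE.comp_perm σ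
    obtain ⟨B, hB⟩ := 𝒯.exists_capacity N hN
    obtain ⟨ι, hι⟩ := h.exists_isFaceEmbedding hA hB hE'
    obtain ⟨F, ψ, hF, hFE, hψ⟩ := hι.exists_distinguishes hE'
    obtain ⟨k, hk⟩ : ∃ k : Fin N, σ k.castSucc = i := by
      have : σ.symm i ≠ Fin.last N := fun he => hj (by rw [← hσj, ← he, σ.apply_symm_apply])
      obtain ⟨k, hk⟩ := Fin.exists_castSucc_eq.2 this
      exact ⟨k, by rw [hk, σ.apply_symm_apply]⟩
    have hface : φ ∈ (𝒯.sys A).zeroFace ((E ∘ σ) (Fin.last N)) := by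
      refine ⟨hφ, ?_⟩
      rw [Function.comp_apply, hσj]
      exact hE.apply_eq_zero_of_apply_eq_one hφ hj.symm hi
    rw [← hι.image_states] at hface
    obtain ⟨x, hx, rfl⟩ := hface
    have hxk : x = ψ k := ih hB hF k hx (by rw [hFE, Function.comp_apply, hk, hi])
    rw [hxk, hψ, Function.comp_apply, hk]

theorem Postulates.mem_pureStates (h : 𝒯.Postulates) {N : ℕ} {A : 𝒯.Sys}
    (hA : (𝒯.sys A).HasCapacity N) {E : Fin N → ((𝒯.sys A).V →L[ℝ] ℝ)} {ω : Fin N → (𝒯.sys A).V}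
    (hE : (𝒯.sys A).Distinguishes E ω) (i : Fin N) : ω i ∈ (𝒯.sys A).pureStates := by
  refine ⟨hE.2.1 i, ?_⟩
  rintro x hx y hy ⟨s, t, hs, ht, hst, hmix⟩
  refine h.eq_of_apply_eq_one N hA hE i hx ?_
  have h1 := hE.apply_self i
  rw [← hmix, map_add, map_smul, map_smul, smul_eq_mul, smul_eq_mul] at h1
  have hx1 := ((𝒯.sys A).effects_prob _ (hE.1.1 i) x hx).2
  have hy1 := ((𝒯.sys A).effects_prob _ (hE.1.1 i) y hy).2
  nlinarith

section MixingBasis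

variable {N : ℕ} {A B : 𝒯.Sys} {E : Fin (N + 1) → ((𝒯.sys A).V →L[ℝ] ℝ)}
  {ω : Fin (N + 1) → (𝒯.sys A).V} {μ : (𝒯.sys A).V}

/-- If the maximally mixed state is the uniform mixture of the distinguishable states `ω i`, then a
reversible transformation that preserves the face spanned by all but the last of them fixes the
last one. -/
theorem Postulates.apply_last_eq (h : 𝒯.Postulates) (hA : (𝒯.sys A).HasCapacity (N + 1))
    (hE : (𝒯.sys A).Distinguishes E ω) (hμ : (𝒯.sys A).IsInvariantState μ)
    (hsum : ∑ i, ω i = ((N + 1 : ℕ) : ℝ) • μ) {T : (𝒯.sys A).V ≃L[ℝ] (𝒯.sys A).V}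
    (hT : T ∈ (𝒯.sys A).G)
    (hface : T '' (𝒯.sys A).zeroFace (E (Fin.last N)) = (𝒯.sys A).zeroFace (E (Fin.last N))) :
    T (ω (Fin.last N)) = ω (Fin.last N) := by
  refine h.eq_of_apply_eq_one _ hA hE _ (System.apply_mem_states hT (hE.2.1 _)) ?_
  have h1 := congrArg (fun v => E (Fin.last N) (T v)) hsum
  have h2 := congrArg (fun v => E (Fin.last N) v) hsum
  simp only [map_add, map_sum, map_smul, hμ.2 T hT, Fin.sum_univ_castSucc] at h1 h2
  have h3 : ∀ k : Fin N, E (Fin.last N) (ω k.castSucc) = 0 := fun k =>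
    hE.apply_of_ne (Fin.castSucc_lt_last k).ne'
  have h4 : ∀ k : Fin N, E (Fin.last N) (T (ω k.castSucc)) = 0 := fun k => by
    have : T (ω k.castSucc) ∈ T '' (𝒯.sys A).zeroFace (E (Fin.last N)) :=
      Set.mem_image_of_mem T (hE.mem_zeroFace (Fin.castSucc_lt_last k).ne')
    rw [hface] at this
    exact this.2
  simp only [h3, h4, Finset.sum_const_zero, zero_add, hE.apply_self] at h1 h2
  rw [h1, ← h2]

theorem Postulates.exists_apply_castSucc_eq (h : 𝒯.Postulates)
    (hA : (𝒯.sys A).HasCapacity (N + 1)) (hE : (𝒯.sys A).Distinguishes E ω)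
    (hμ : (𝒯.sys A).IsInvariantState μ) (hsum : ∑ i, ω i = ((N + 1 : ℕ) : ℝ) • μ) (k l : Fin N) :
    ∃ T ∈ (𝒯.sys A).G, T (ω (Fin.last N)) = ω (Fin.last N) ∧
      T (ω k.castSucc) = ω l.castSucc := by
  obtain ⟨B, hB⟩ := 𝒯.exists_capacity N (Nat.one_le_iff_ne_zero.2 fun h0 => by
    subst h0; exact k.elim0)
  obtain ⟨ι, hι⟩ := h.exists_isFaceEmbedding hA hB hE
  obtain ⟨F, ψ, hF, -, hψ⟩ := hι.exists_distinguishes hE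
  obtain ⟨U, hU, hUk⟩ := h.isSymmetric B _ (h.mem_pureStates hB hF k) _ (h.mem_pureStates hB hF l)
  obtain ⟨T, hT, hface, hTU⟩ := hι.exists_extension U hU
  exact ⟨T, hT, h.apply_last_eq hA hE hμ hsum hT hface, by rw [← hψ, hTU, hUk, hψ]⟩

/-- Any two of the states that mix to the maximally mixed state are exchanged by reversible
transformations fixing any given third one. -/
theorem Postulates.exists_fix_move (h : 𝒯.Postulates)
    (hA : (𝒯.sys A).HasCapacity (N + 1)) (hE : (𝒯.sys A).Distinguishes E ω)
    (hμ : (𝒯.sys A).IsInvariantState μ) (hsum : ∑ i, ω i = ((N + 1 : ℕ) : ℝ) • μ)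
    {j k l : Fin (N + 1)} (hk : k ≠ j) (hl : l ≠ j) :
    ∃ T ∈ (𝒯.sys A).G, T (ω j) = ω j ∧ T (ω k) = ω l := by
  set σ := Equiv.swap j (Fin.last N) with hσ
  have hσj : σ (Fin.last N) = j := Equiv.swap_apply_right _ _
  have hex : ∀ i, i ≠ j → ∃ k : Fin N, σ k.castSucc = i := by
    intro i hi
    have : σ.symm i ≠ Fin.last N := fun he => hi (by rw [← hσj, ← he, σ.apply_symm_apply])
    obtain ⟨k, hk⟩ := Fin.exists_castSucc_eq.2 this
    exact ⟨k, by rw [hk, σ.apply_symm_apply]⟩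
  obtain ⟨k', hk'⟩ := hex k hk
  obtain ⟨l', hl'⟩ := hex l hl
  obtain ⟨T, hT, h1, h2⟩ := h.exists_apply_castSucc_eq hA (hE.comp_perm σ) hμ
    ((Equiv.sum_comp σ ω).trans hsum) k' l'
  refine ⟨T, hT, ?_, ?_⟩
  · simpa only [Function.comp_apply, hσj] using h1
  · simpa only [Function.comp_apply, hk', hl'] using h2

end MixingBasis

/-- Mixing bases restrict to faces: the sum of all but the last element of a mixing basis is fixed
by the transformations that preserve their face, as these fix the last element and the maximally
mixed state. -/
theorem Postulates.hasMixingBasis_of_succ (h : 𝒯.Postulates) {N : ℕ} {A B : 𝒯.Sys}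
    (hA : (𝒯.sys A).HasMixingBasis (N + 1)) (hB : (𝒯.sys B).HasCapacity N) :
    (𝒯.sys B).HasMixingBasis N := by
  obtain ⟨hcap, E, ω, μ, hE, hμ, hsum⟩ := hA
  obtain ⟨ι, hι⟩ := h.exists_isFaceEmbedding hcap hB hE
  obtain ⟨F, ψ, hF, -, hψ⟩ := hι.exists_distinguishes hE
  have hN : (N : ℝ) ≠ 0 := by
    have := hB.one_le
    exact_mod_cast (by omega : N ≠ 0)
  refine ⟨hB, F, ψ, (N : ℝ)⁻¹ • ∑ k, ψ k, hF, ⟨?_, fun U hU => ?_⟩, ?_⟩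
  · rw [Finset.smul_sum]
    refine (𝒯.sys B).states_convex.sum_mem (fun _ _ => by positivity) ?_ fun k _ => hF.2.1 k
    simp [hN]
  · obtain ⟨T, hT, hface, hTU⟩ := hι.exists_extension U hU
    have hlast := h.apply_last_eq hcap hE hμ hsum hT hface
    have hS : ι (∑ k, ψ k) = ((N + 1 : ℕ) : ℝ) • μ - ω (Fin.last N) := by
      rw [← hsum, Fin.sum_univ_castSucc, add_sub_cancel_right, map_sum]
      exact Finset.sum_congr rfl fun k _ => hψ k
    rw [map_smul]
    congr 1
    apply hι.injective
    rw [← hTU, hS, map_sub, map_smul, hμ.2 T hT, hlast]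
  · rw [smul_smul, mul_inv_cancel₀ hN, one_smul]

/-- The capacity is multiplicative, and products of mixing bases are mixing bases. -/
theorem Postulates.hasMixingBasis_comp (h : 𝒯.Postulates) {M N : ℕ} {A B : 𝒯.Sys}
    (hA : (𝒯.sys A).HasMixingBasis M) (hB : (𝒯.sys B).HasMixingBasis N) :
    (𝒯.sys (𝒯.comp A B)).HasMixingBasis (M * N) := by
  obtain ⟨hAc, E, ω, μA, hE, hμA, hsumA⟩ := hA
  obtain ⟨hBc, F, φ, μB, hF, hμB, hsumB⟩ := hB
  set C := 𝒯.composite A B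
  have hC : C.LocallyTomographic := h.localTomography A B
  obtain ⟨μ, hμ⟩ := (𝒯.sys (𝒯.comp A B)).exists_isInvariantState
  have hμst : μ = C.st μA μB :=
    C.eq_st_of_isInvariantState hC (h.isSymmetric A) (h.isSymmetric B) hμA hμB hμ
  set e := (finProdFinEquiv (m := M) (n := N)).symm
  set EF : Fin (M * N) → _ := fun p => C.eff (E (e p).1) (F (e p).2)
  set st : Fin (M * N) → _ := fun p => C.st (ω (e p).1) (φ (e p).2)
  have hdist : (𝒯.sys (𝒯.comp A B)).Distinguishes EF st := by
    refine ⟨⟨fun p => C.eff_mem _ (hE.1.1 _) _ (hF.1.1 _), ?_⟩,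
      fun p => C.st_mem _ (hE.2.1 _) _ (hF.2.1 _), fun p q => ?_⟩
    · rw [← C.eff_unit, ← hE.1.2, ← hF.1.2, LinearMap.map_sum₂]
      simp only [map_sum]
      rw [Equiv.sum_comp e (fun p => C.eff (E p.1) (F p.2)), Fintype.sum_prod_type]
    · have hpq : p = q ↔ (e p).1 = (e q).1 ∧ (e p).2 = (e q).2 := by
        rw [← Prod.ext_iff, e.injective.eq_iff]
      rw [C.eff_st, hE.2.2, hF.2.2]
      by_cases h1 : (e p).1 = (e q).1 <;> by_cases h2 : (e p).2 = (e q).2 <;>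
        simp [h1, h2, hpq]
  have hsum : ∑ p, st p = ((M * N : ℕ) : ℝ) • μ := by
    rw [hμst, Equiv.sum_comp e (fun p => C.st (ω p.1) (φ p.2)), Fintype.sum_prod_type]
    have : C.st (∑ i, ω i) (∑ j, φ j) = ∑ i, ∑ j, C.st (ω i) (φ j) := by
      rw [LinearMap.map_sum₂]
      simp only [map_sum]
    rw [← this, hsumA, hsumB, LinearMap.map_smul₂, map_smul, smul_smul, Nat.cast_mul]
  have hMN : 1 ≤ M * N := Nat.mul_pos hAc.one_le hBc.one_le
  have : Nonempty (Fin (M * N)) := ⟨⟨0, hMN⟩⟩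
  have hpure : ∀ p, st p ∈ (𝒯.sys (𝒯.comp A B)).pureStates := fun p =>
    C.st_mem_pureStates hC (h.mem_pureStates hAc hE _) (h.mem_pureStates hBc hF _)
  refine ⟨⟨⟨EF, st, hdist⟩, ?_⟩, EF, st, μ, hdist, hμ, hsum⟩
  rintro n ⟨G, ψ, hG⟩
  -- each of the `n` effects has probability at least `1 / (M * N)` on `μ`, and these add up to `1`
  have hle : ∀ i, 1 ≤ ((M * N : ℕ) : ℝ) * G i μ := fun i => by
    have := (h.isSymmetric _).one_le_mul_apply hpure hμ (by rw [Fintype.card_fin]; exact hsum)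
      (hG.1.1 i) (hG.2.1 i) (hG.apply_self i)
    rwa [Fintype.card_fin] at this
  have := Finset.sum_le_sum fun i (_ : i ∈ Finset.univ) => hle i
  rw [← Finset.mul_sum, hG.sum_apply hμ.1] at this
  simp at this
  exact_mod_cast this

/-- Systems of capacity `N` are all equivalent to the same face of a system of capacity `N + 1`. -/
theorem Postulates.K_eq_of_hasCapacity (h : 𝒯.Postulates) {N : ℕ} {A B : 𝒯.Sys}
    (hA : (𝒯.sys A).HasCapacity N) (hB : (𝒯.sys B).HasCapacity N) :
    (𝒯.sys A).K = (𝒯.sys B).K := by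
  obtain ⟨D, hD⟩ := 𝒯.exists_capacity (N + 1) (by omega)
  obtain ⟨E, ω, hE⟩ := hD.1
  obtain ⟨ι, hι⟩ := h.exists_isFaceEmbedding hD hA hE
  obtain ⟨κ, hκ⟩ := h.exists_isFaceEmbedding hD hB hE
  rw [hι.K_eq_finrank, hκ.K_eq_finrank]

theorem Postulates.K_lt_of_succ (h : 𝒯.Postulates) {N : ℕ} {A B : 𝒯.Sys}
    (hA : (𝒯.sys A).HasCapacity (N + 1)) (hB : (𝒯.sys B).HasCapacity N) :
    (𝒯.sys B).K < (𝒯.sys A).K := by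
  obtain ⟨E, ω, hE⟩ := hA.1
  obtain ⟨ι, hι⟩ := h.exists_isFaceEmbedding hA hB hE
  have hlt : Submodule.span ℝ ((𝒯.sys A).zeroFace (E (Fin.last N))) < ⊤ := by
    rw [lt_top_iff_ne_top]
    intro htop
    have hle : Submodule.span ℝ ((𝒯.sys A).zeroFace (E (Fin.last N))) ≤
        LinearMap.ker ((E (Fin.last N)) : (𝒯.sys A).V →ₗ[ℝ] ℝ) :=
      Submodule.span_le.2 fun x hx => hx.2
    have : ω (Fin.last N) ∈ LinearMap.ker ((E (Fin.last N)) : (𝒯.sys A).V →ₗ[ℝ] ℝ) :=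
      hle (htop ▸ Submodule.mem_top)
    have h0 : E (Fin.last N) (ω (Fin.last N)) = 0 := this
    rw [hE.apply_self] at h0
    exact one_ne_zero h0
  have := Submodule.finrank_lt_finrank_of_lt hlt
  rw [← hι.K_eq_finrank] at this
  simpa using this

theorem Postulates.K_eq_one (h : 𝒯.Postulates) {A : 𝒯.Sys} (hA : (𝒯.sys A).HasCapacity 1) :
    (𝒯.sys A).K = 1 := by
  obtain ⟨x, hx⟩ := (𝒯.sys A).states_nonempty
  have hS : (𝒯.sys A).states = {x} := (h.subsingleton_states hA).eq_singleton_of_mem hx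
  have hx0 : x ≠ 0 := by
    rintro rfl
    simpa using (𝒯.sys A).states_normalized _ hx
  have h1 := (𝒯.sys A).states_span
  rw [hS] at h1
  have h2 := finrank_span_singleton (K := ℝ) hx0
  rw [h1] at h2
  simpa using h2

end Theory

/-! ### Ball coordinates -/

namespace System

variable {A : System} {d : ℕ} {L : A.V ≃ₗ[ℝ] (Fin (d + 1) → ℝ)}

namespace IsBallCoordinates

theorem mem_states_iff (hL : A.IsBallCoordinates d L) {v : A.V} :
    v ∈ A.states ↔ L v 0 = 1 ∧ ∑ i : Fin d, L v i.succ ^ 2 ≤ 1 := by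
  rw [← L.injective.mem_set_image, hL]; rfl

theorem unit_apply (hL : A.IsBallCoordinates d L) (v : A.V) : A.unit v = L v 0 := by
  have : (A.unit : A.V →ₗ[ℝ] ℝ) = LinearMap.proj 0 ∘ₗ L.toLinearMap :=
    linearMap_ext_states fun ω hω => by
      change A.unit ω = L ω 0
      rw [A.states_normalized ω hω, (hL.mem_states_iff.1 hω).1]
  exact LinearMap.congr_fun this v

end IsBallCoordinates

/-- The vector with ball coordinates `(1, x)`. -/
def ballPoint (L : A.V ≃ₗ[ℝ] (Fin (d + 1) → ℝ)) (x : Fin d → ℝ) : A.V :=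
  L.symm (Fin.cons 1 x)

/-- The functional `(t, y) ↦ (t + x ⬝ᵥ y) / 2` in ball coordinates. -/
noncomputable def ballEffect (L : A.V ≃ₗ[ℝ] (Fin (d + 1) → ℝ)) (x : Fin d → ℝ) : A.V →L[ℝ] ℝ :=
  LinearMap.toContinuousLinearMap
    { toFun := fun v => (L v 0 + ∑ i, x i * L v i.succ) / 2
      map_add' := fun v w => by
        simp only [map_add, Pi.add_apply, mul_add, Finset.sum_add_distrib]; ring
      map_smul' := fun c v => by
        simp only [map_smul, Pi.smul_apply, smul_eq_mul, RingHom.id_apply, mul_left_comm,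
          ← Finset.mul_sum]
        ring }

theorem ballEffect_apply (x : Fin d → ℝ) (v : A.V) :
    ballEffect L x v = (L v 0 + ∑ i, x i * L v i.succ) / 2 := rfl

@[simp] theorem apply_ballPoint (x : Fin d → ℝ) : L (ballPoint L x) = Fin.cons 1 x :=
  L.apply_symm_apply _

theorem ballEffect_ballPoint (x y : Fin d → ℝ) :
    ballEffect L x (ballPoint L y) = (1 + x ⬝ᵥ y) / 2 := by
  simp [ballEffect_apply, dotProduct]

theorem ballPoint_add_ballPoint_neg (x : Fin d → ℝ) :
    ballPoint L x + ballPoint L (-x) = (2 : ℝ) • ballPoint L 0 := by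
  apply L.injective
  rw [map_add, map_smul, apply_ballPoint, apply_ballPoint, apply_ballPoint]
  ext i
  refine Fin.cases ?_ (fun j => ?_) i
  · simp; norm_num
  · simp

namespace IsBallCoordinates

theorem ballPoint_mem (hL : A.IsBallCoordinates d L) {x : Fin d → ℝ} (hx : x ⬝ᵥ x ≤ 1) :
    ballPoint L x ∈ A.states := by
  rw [hL.mem_states_iff]
  simpa [dotProduct, sq] using hx

theorem ballEffect_mem_Icc (hL : A.IsBallCoordinates d L) {x : Fin d → ℝ} (hx : x ⬝ᵥ x = 1)
    {ω : A.V} (hω : ω ∈ A.states) : 0 ≤ ballEffect L x ω ∧ ballEffect L x ω ≤ 1 := by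
  obtain ⟨h0, h1⟩ := hL.mem_states_iff.1 hω
  have hcs := Finset.sum_mul_sq_le_sq_mul_sq Finset.univ x fun i => L ω i.succ
  have hx' : ∑ i, x i ^ 2 = 1 := by simpa [dotProduct, sq] using hx
  rw [hx', one_mul] at hcs
  have := abs_le.1 ((sq_le_one_iff_abs_le_one _).1 (hcs.trans h1))
  rw [ballEffect_apply, h0]
  constructor <;> linarith

theorem ballEffect_add_neg (hL : A.IsBallCoordinates d L) (x : Fin d → ℝ) :
    ballEffect L x + ballEffect L (-x) = A.unit := by
  ext1 v
  rw [add_apply, ballEffect_apply, ballEffect_apply, hL.unit_apply]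
  simp; ring

theorem distinguishes (hL : A.IsBallCoordinates d L)
    (hall : ∀ E : A.V →L[ℝ] ℝ, (∀ ω ∈ A.states, 0 ≤ E ω ∧ E ω ≤ 1) → E ∈ A.effects)
    {x : Fin d → ℝ} (hx : x ⬝ᵥ x = 1) :
    A.Distinguishes ![ballEffect L x, ballEffect L (-x)] ![ballPoint L x, ballPoint L (-x)] := by
  have hx' : (-x) ⬝ᵥ (-x) = 1 := by simpa using hx
  refine ⟨⟨?_, ?_⟩, ?_, ?_⟩
  · intro i
    fin_cases i
    exacts [hall _ fun _ => hL.ballEffect_mem_Icc hx, hall _ fun _ => hL.ballEffect_mem_Icc hx']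
  · simpa using hL.ballEffect_add_neg x
  · intro j
    fin_cases j
    exacts [hL.ballPoint_mem hx.le, hL.ballPoint_mem hx'.le]
  · intro i j
    fin_cases i <;> fin_cases j <;> simp [ballEffect_ballPoint, hx]

theorem two_smul_center_sub_mem (hL : A.IsBallCoordinates d L) {ω : A.V} (hω : ω ∈ A.states) :
    (2 : ℝ) • ballPoint L 0 - ω ∈ A.states := by
  obtain ⟨h0, h1⟩ := hL.mem_states_iff.1 hω
  rw [hL.mem_states_iff, map_sub, map_smul, apply_ballPoint]
  constructor
  · simp [h0]; norm_num
  · simpa using h1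

/-- The center of the ball is invariant, since a bounded set has at most one center of
symmetry. -/
theorem isInvariantState_center (hL : A.IsBallCoordinates d L) :
    A.IsInvariantState (ballPoint L 0) := by
  have hc : ballPoint L 0 ∈ A.states := hL.ballPoint_mem (by simp)
  refine ⟨hc, fun T hT => ?_⟩
  set c := ballPoint L 0
  have hstep : ∀ ω ∈ A.states, ω + (2 : ℝ) • (T c - c) ∈ A.states := by
    intro ω hω
    have h1 := hL.two_smul_center_sub_mem hω
    rw [← A.G_states T hT] at h1
    obtain ⟨φ, hφ, hTφ⟩ := h1
    have h2 := apply_mem_states hT (hL.two_smul_center_sub_mem hφ)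
    rw [map_sub, map_smul, hTφ] at h2
    convert h2 using 1
    rw [smul_sub]; abel
  have hiter : ∀ n : ℕ, c + (n : ℝ) • (2 : ℝ) • (T c - c) ∈ A.states := by
    intro n
    induction n with
    | zero => simpa using hc
    | succ n ih =>
      have := hstep _ ih
      rwa [add_assoc, show (n : ℝ) • (2 : ℝ) • (T c - c) + (2 : ℝ) • (T c - c) =
        ((n + 1 : ℕ) : ℝ) • (2 : ℝ) • (T c - c) by push_cast; rw [add_smul, one_smul]] at this
  obtain ⟨R, hR⟩ := A.states_compact.isBounded.exists_norm_le
  by_contra hne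
  have hpos : 0 < ‖(2 : ℝ) • (T c - c)‖ :=
    norm_pos_iff.2 (smul_ne_zero two_ne_zero (sub_ne_zero.2 hne))
  obtain ⟨n, hn⟩ := exists_nat_gt ((R + R) / ‖(2 : ℝ) • (T c - c)‖)
  rw [div_lt_iff₀ hpos] at hn
  have h1 := norm_sub_le (c + (n : ℝ) • (2 : ℝ) • (T c - c)) c
  rw [add_sub_cancel_left, norm_smul, Real.norm_natCast] at h1
  linarith [hR _ hc, hR _ (hiter n)]

theorem one_le_dim (hL : A.IsBallCoordinates d L) (hA : A.HasCapacity 2) : 1 ≤ d := by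
  by_contra! hd
  obtain rfl : d = 0 := by omega
  obtain ⟨x, hx, y, hy, hxy⟩ := hA.exists_ne
  apply hxy
  apply L.injective
  ext i
  rw [Fin.fin_one_eq_zero i, (hL.mem_states_iff.1 hx).1, (hL.mem_states_iff.1 hy).1]

theorem K_eq (_ : A.IsBallCoordinates d L) : A.K = d + 1 := by
  simpa using L.finrank_eq

end IsBallCoordinates

theorem exists_dotProduct_self_eq_one (hd : 1 ≤ d) : ∃ x : Fin d → ℝ, x ⬝ᵥ x = 1 :=
  ⟨Pi.single ⟨0, hd⟩ 1, by simp⟩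

/-- A state space that is the intersection of the normalization hyperplane with a ball centered at
a state, in some Euclidean structure, has ball coordinates. -/
theorem exists_isBallCoordinates_of_norm_le {n : ℕ} (hK : A.K = d + 1)
    (Q : A.V ≃ₗ[ℝ] EuclideanSpace ℝ (Fin n)) {μ : A.V} (hμ : A.unit μ = 1) {R : ℝ} (hR : 0 < R)
    (hS : ∀ v, v ∈ A.states ↔ A.unit v = 1 ∧ ‖Q (v - μ)‖ ≤ R) :
    ∃ L, A.IsBallCoordinates d L := by
  set u : EuclideanSpace ℝ (Fin n) →ₗ[ℝ] ℝ := (A.unit : A.V →ₗ[ℝ] ℝ) ∘ₗ Q.symm.toLinearMap with hu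
  have huQ : ∀ v, u (Q v) = A.unit v := fun v => by simp [hu]
  have hu0 : u ≠ 0 := by
    intro h
    have := huQ μ
    rw [h, hμ] at this
    exact zero_ne_one this
  have hn : n = d + 1 := by
    have := Q.finrank_eq
    simp at this
    omega
  have hker : Module.finrank ℝ (LinearMap.ker u) = d := by
    have := Module.Dual.finrank_ker_add_one_of_ne_zero (f := u) hu0
    simp at this
    omega
  set b : OrthonormalBasis (Fin d) ℝ (LinearMap.ker u) :=
    (stdOrthonormalBasis ℝ (LinearMap.ker u)).reindex (finCongr hker)
  -- the component of `v` parallel to the hyperplane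
  have hP : ∀ v, Q (v - A.unit v • μ) ∈ LinearMap.ker u := fun v => by
    rw [LinearMap.mem_ker, huQ, map_sub, map_smul, hμ, smul_eq_mul, mul_one, sub_self]
  set L₀ : A.V →ₗ[ℝ] (Fin (d + 1) → ℝ) :=
    { toFun := fun v => Fin.cons (A.unit v)
        fun i => R⁻¹ * inner ℝ (b i : EuclideanSpace ℝ (Fin n)) (Q (v - A.unit v • μ))
      map_add' := fun v w => by
        ext i
        refine Fin.cases ?_ (fun j => ?_) i
        · simp
        · simp only [map_add, map_sub, map_smul, Fin.cons_succ, Pi.add_apply, inner_add_right,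
            inner_sub_right, real_inner_smul_right]
          ring
      map_smul' := fun c v => by
        ext i
        refine Fin.cases ?_ (fun j => ?_) i
        · simp
        · simp only [map_sub, map_smul, Fin.cons_succ, Pi.smul_apply, smul_eq_mul,
            inner_sub_right, real_inner_smul_right, RingHom.id_apply]
          ring } with hL₀
  have h0 : ∀ v, L₀ v 0 = A.unit v := fun v => rfl
  have hsum : ∀ v, ∑ i : Fin d, L₀ v i.succ ^ 2 = R⁻¹ ^ 2 * ‖Q (v - A.unit v • μ)‖ ^ 2 := by
    intro v
    have h1 := b.sum_sq_norm_inner_right ⟨_, hP v⟩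
    simp only [Submodule.coe_inner, Submodule.coe_norm, Real.norm_eq_abs, sq_abs] at h1
    rw [← h1, Finset.mul_sum]
    refine Finset.sum_congr rfl fun i _ => ?_
    rw [← mul_pow]; rfl
  have hinj : Function.Injective L₀ := by
    rw [injective_iff_map_eq_zero]
    intro v hv
    have hv0 : A.unit v = 0 := by rw [← h0, hv]; rfl
    have h1 := hsum v
    simp only [hv, Pi.zero_apply, hv0, zero_smul, sub_zero] at h1
    have h2 : ‖Q v‖ = 0 := by
      have : R⁻¹ ^ 2 * ‖Q v‖ ^ 2 = 0 := by rw [← h1]; simp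
      simpa [hR.ne'] using this
    exact Q.map_eq_zero_iff.1 (norm_eq_zero.1 h2)
  refine ⟨LinearMap.linearEquivOfInjective L₀ hinj (by simp [hK]), ?_⟩
  have hmem : ∀ v, v ∈ A.states ↔ L₀ v ∈ {x : Fin (d + 1) → ℝ |
      x 0 = 1 ∧ ∑ i : Fin d, x i.succ ^ 2 ≤ 1} := by
    intro v
    change v ∈ A.states ↔ L₀ v 0 = 1 ∧ ∑ i : Fin d, L₀ v i.succ ^ 2 ≤ 1
    rw [hS, h0, hsum]
    refine and_congr_right fun hv => ?_
    rw [hv, one_smul, ← mul_pow, sq_le_one_iff₀ (by positivity), inv_mul_le_iff₀ hR, mul_one]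
  ext x
  constructor
  · rintro ⟨v, hv, rfl⟩
    exact (hmem v).1 hv
  · intro hx
    obtain ⟨v, rfl⟩ := (LinearMap.linearEquivOfInjective L₀ hinj (by simp [hK])).surjective x
    exact ⟨v, (hmem v).2 hx, rfl⟩

end System

/-! ### Bits are balls of odd dimension -/

namespace Theory

variable {𝒯 : Theory}

/-- A state of a bit at which a nonconstant functional is maximal is pure. -/
theorem Postulates.mem_pureStates_of_isMax (h : 𝒯.Postulates) {A : 𝒯.Sys}
    (hA : (𝒯.sys A).HasCapacity 2) (f : (𝒯.sys A).V →L[ℝ] ℝ) {y : (𝒯.sys A).V}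
    (hy : y ∈ (𝒯.sys A).states) (hmax : ∀ x ∈ (𝒯.sys A).states, f x ≤ f y)
    (hnc : ∃ z ∈ (𝒯.sys A).states, f z < f y) : y ∈ (𝒯.sys A).pureStates := by
  obtain ⟨E, ⟨-, ω, hE⟩, hface⟩ := System.exists_isCompleteMeasurement_zeroFace_eq hA
    (h.allBitEffectsAllowed A hA) f hy hmax hnc
  have hy' : y ∈ (𝒯.sys A).zeroFace (E (Fin.last 1)) := hface ▸ ⟨hy, rfl⟩
  have h1 := hE.sum_apply hy
  rw [Fin.sum_univ_castSucc, hy'.2, add_zero, Fin.sum_univ_one] at h1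
  rw [h.eq_of_apply_eq_one 2 hA hE _ hy h1]
  exact h.mem_pureStates hA hE _

/-- Bits are balls. The pure states lie on a sphere around the maximally mixed state `μ`, in an
invariant Euclidean structure. If a point `x` of the ball were not a state, then the state `y`
nearest to it would maximize the functional `⟪x - y, ·⟫`, so that `y` is pure; but the angle at `y`
between `x` and `μ` is obtuse, so that `y` is closer to `μ` than `x`. -/
theorem Postulates.exists_isBallCoordinates (h : 𝒯.Postulates) {A : 𝒯.Sys}
    (hA : (𝒯.sys A).HasCapacity 2) {d : ℕ} (hd : (𝒯.sys A).K = d + 1) :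
    ∃ L, (𝒯.sys A).IsBallCoordinates d L := by
  obtain ⟨Q, hQ⟩ := (𝒯.sys A).exists_euclidean
  obtain ⟨μ, hμ⟩ := (𝒯.sys A).exists_isInvariantState
  obtain ⟨ω, hω⟩ := (𝒯.sys A).pureStates_nonempty
  have hcont : Continuous Q := Q.toLinearMap.continuous_of_finiteDimensional
  have hμ1 : (𝒯.sys A).unit μ = 1 := (𝒯.sys A).states_normalized μ hμ.1
  set R := ‖Q (ω - μ)‖ with hR
  have hpure : ∀ φ ∈ (𝒯.sys A).pureStates, ‖Q (φ - μ)‖ = R := by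
    intro φ hφ
    obtain ⟨T, hT, rfl⟩ := h.isSymmetric A ω hω φ hφ
    have : T ω - μ = T (ω - μ) := by rw [map_sub, hμ.2 T hT]
    rw [hR, this, ← sq_eq_sq₀ (norm_nonneg _) (norm_nonneg _), ← real_inner_self_eq_norm_sq,
      ← real_inner_self_eq_norm_sq, hQ T hT]
  have hsub : (𝒯.sys A).states ⊆ {φ | ‖Q (φ - μ)‖ ≤ R} := by
    refine System.states_subset_of_pureStates_subset
      (isClosed_le (hcont.comp (continuous_id.sub continuous_const)).norm continuous_const) ?_
      fun φ hφ => (hpure φ hφ).le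
    intro x hx y hy a b ha hb hab
    have e : a • x + b • y - μ = a • (x - μ) + b • (y - μ) := by
      rw [smul_sub, smul_sub, sub_add_sub_comm, ← add_smul, hab, one_smul]
    have hx' : ‖Q (x - μ)‖ ≤ R := hx
    have hy' : ‖Q (y - μ)‖ ≤ R := hy
    change ‖Q (a • x + b • y - μ)‖ ≤ R
    rw [e, map_add, map_smul, map_smul]
    refine (norm_add_le _ _).trans ?_
    rw [norm_smul, norm_smul, Real.norm_of_nonneg ha, Real.norm_of_nonneg hb]
    calc a * ‖Q (x - μ)‖ + b * ‖Q (y - μ)‖ ≤ a * R + b * R := by gcongr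
      _ = R := by rw [← add_mul, hab, one_mul]
  have hRpos : 0 < R := by
    refine (norm_nonneg _).lt_of_ne fun h0 => ?_
    have e : ∀ x ∈ (𝒯.sys A).states, x = μ := fun x hx => by
      have h1 : ‖Q (x - μ)‖ ≤ R := hsub hx
      rw [hR, ← h0] at h1
      exact sub_eq_zero.1 (Q.map_eq_zero_iff.1 (norm_le_zero_iff.1 h1))
    obtain ⟨x, hx, y, hy, hxy⟩ := hA.exists_ne
    exact hxy ((e x hx).trans (e y hy).symm)
  refine System.exists_isBallCoordinates_of_norm_le hd Q hμ1 hRpos fun x =>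
    ⟨fun hx => ⟨(𝒯.sys A).states_normalized x hx, hsub hx⟩, fun ⟨hx1, hxR⟩ => ?_⟩
  by_contra hx
  have hconv : Convex ℝ (Q '' (𝒯.sys A).states) :=
    (𝒯.sys A).states_convex.linear_image Q.toLinearMap
  obtain ⟨_, ⟨y, hy, rfl⟩, hmin⟩ := exists_norm_eq_iInf_of_complete_convex
    ((𝒯.sys A).states_nonempty.image Q)
    ((𝒯.sys A).states_compact.image hcont).isComplete hconv (Q x)
  rw [norm_eq_iInf_iff_real_inner_le_zero hconv (Set.mem_image_of_mem Q hy)] at hmin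
  have hmin' : ∀ z ∈ (𝒯.sys A).states, inner ℝ (Q (x - y)) (Q (z - y)) ≤ (0 : ℝ) := fun z hz => by
    rw [map_sub, map_sub]; exact hmin _ (Set.mem_image_of_mem Q hz)
  set f : (𝒯.sys A).V →L[ℝ] ℝ :=
    LinearMap.toContinuousLinearMap ((innerₗ _ (Q (x - y))) ∘ₗ Q.toLinearMap) with hf
  have hfv : ∀ v, f v = inner ℝ (Q (x - y)) (Q v) := fun v => rfl
  have hmax : ∀ z ∈ (𝒯.sys A).states, f z ≤ f y := fun z hz => by
    have := hmin' z hz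
    rw [map_sub Q z, inner_sub_right] at this
    rw [hfv, hfv]; linarith
  have hyp : y ∈ (𝒯.sys A).pureStates := by
    refine h.mem_pureStates_of_isMax hA f hy hmax ?_
    by_contra! hcon
    have he : (f : (𝒯.sys A).V →ₗ[ℝ] ℝ) = f y • ((𝒯.sys A).unit : (𝒯.sys A).V →ₗ[ℝ] ℝ) :=
      System.linearMap_ext_states fun z hz => by
        have := le_antisymm (hmax z hz) (hcon z hz)
        simpa [(𝒯.sys A).states_normalized z hz] using this
    have h1 : f (x - y) = f y * (𝒯.sys A).unit (x - y) := LinearMap.congr_fun he (x - y)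
    rw [map_sub (𝒯.sys A).unit, hx1, (𝒯.sys A).states_normalized y hy, sub_self, mul_zero,
      hfv] at h1
    have h2 : x = y := sub_eq_zero.1 (Q.map_eq_zero_iff.1 (inner_self_eq_zero.1 h1))
    exact hx (h2 ▸ hy)
  have h1 := hpure y hyp
  have h2 := hmin' μ hμ.1
  have h3 : Q (x - μ) = Q (x - y) - Q (μ - y) := by rw [← map_sub]; congr 1; abel
  have h4 := norm_sub_sq_real (Q (x - y)) (Q (μ - y))
  have h5 : ‖Q (μ - y)‖ = R := by rw [← h1, ← norm_neg, ← map_neg, neg_sub]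
  rw [← h3, h5] at h4
  have h6 : 0 < ‖Q (x - y)‖ := norm_pos_iff.2 fun h0 =>
    hx (sub_eq_zero.1 (Q.map_eq_zero_iff.1 h0) ▸ hy)
  nlinarith [norm_nonneg (Q (x - μ))]

theorem Postulates.hasMixingBasis_two (h : 𝒯.Postulates) {A : 𝒯.Sys}
    (hA : (𝒯.sys A).HasCapacity 2) : (𝒯.sys A).HasMixingBasis 2 := by
  have hK : (𝒯.sys A).K = ((𝒯.sys A).K - 1) + 1 := by
    obtain ⟨B, hB⟩ := 𝒯.exists_capacity 1 le_rfl
    have := h.K_lt_of_succ hA hB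
    omega
  obtain ⟨L, hL⟩ := h.exists_isBallCoordinates hA hK
  obtain ⟨x, hx⟩ := System.exists_dotProduct_self_eq_one (hL.one_le_dim hA)
  refine ⟨hA, _, _, _, hL.distinguishes (h.allBitEffectsAllowed A hA) hx,
    hL.isInvariantState_center, ?_⟩
  simpa using System.ballPoint_add_ballPoint_neg (L := L) x

/-- Mixing bases exist in every capacity: in capacity `2 ^ k` by composing bits, and from there
downwards by passing to faces. -/
theorem Postulates.exists_hasMixingBasis (h : 𝒯.Postulates) {N : ℕ} (hN : 1 ≤ N) :
    ∃ A, (𝒯.sys A).HasMixingBasis N := by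
  have hpow : ∀ k, ∃ A, (𝒯.sys A).HasMixingBasis (2 ^ (k + 1)) := by
    obtain ⟨A, hA⟩ := 𝒯.exists_capacity 2 (by norm_num)
    intro k
    induction k with
    | zero => exact ⟨A, h.hasMixingBasis_two hA⟩
    | succ k ih =>
      obtain ⟨B, hB⟩ := ih
      exact ⟨_, h.hasMixingBasis_comp hB (h.hasMixingBasis_two hA)⟩
  have hle : N ≤ 2 ^ (N + 1) :=
    Nat.lt_two_pow_self.le.trans (Nat.pow_le_pow_right two_pos (by omega))
  refine Nat.decreasingInduction' (P := fun n => ∃ A, (𝒯.sys A).HasMixingBasis n)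
    (fun k _ hk ⟨A, hA⟩ => ?_) hle (hpow N)
  obtain ⟨B, hB⟩ := 𝒯.exists_capacity k (hN.trans hk)
  exact ⟨B, h.hasMixingBasis_of_succ hA hB⟩

/-- The dimension `K` is a completely multiplicative and strictly increasing function of the
capacity, so its value on bits is even. -/
theorem Postulates.even_K (h : 𝒯.Postulates) {A : 𝒯.Sys} (hA : (𝒯.sys A).HasCapacity 2) :
    Even (𝒯.sys A).K := by
  choose S hS using fun n : ℕ => 𝒯.exists_capacity (n + 1) (by omega)
  set f : ℕ → ℕ := fun n => (𝒯.sys (S (n - 1))).K with hf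
  have hcap : ∀ n, 1 ≤ n → (𝒯.sys (S (n - 1))).HasCapacity n := fun n hn => by
    have := hS (n - 1)
    rwa [Nat.sub_add_cancel hn] at this
  have hfK : ∀ n, 1 ≤ n → ∀ {B : 𝒯.Sys}, (𝒯.sys B).HasCapacity n → f n = (𝒯.sys B).K :=
    fun n hn B hB => h.K_eq_of_hasCapacity (hcap n hn) hB
  have hstep : ∀ n, 1 ≤ n → f n < f (n + 1) := fun n hn =>
    h.K_lt_of_succ (hcap (n + 1) (by omega)) (hcap n hn)
  rw [← hfK 2 (by norm_num) hA]
  refine even_apply_two_of_multiplicative (h.K_eq_one (hcap 1 le_rfl)) (fun m n hm hn => ?_)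
    fun m n hm hmn => ?_
  · obtain ⟨B, hB⟩ := h.exists_hasMixingBasis hm
    obtain ⟨D, hD⟩ := h.exists_hasMixingBasis hn
    rw [hfK m hm hB.1, hfK n hn hD.1,
      hfK (m * n) (Nat.mul_pos hm hn) (h.hasMixingBasis_comp hB hD).1]
    exact (𝒯.composite B D).K_eq_mul (h.localTomography B D)
  · induction n, hmn using Nat.le_induction with
    | base => exact hstep m hm
    | succ n hmn ih => exact ih.trans (hstep n (by omega))

theorem Postulates.odd_of_isBallCoordinates (h : 𝒯.Postulates) {A : 𝒯.Sys}
    (hA : (𝒯.sys A).HasCapacity 2) {d : ℕ} {L : (𝒯.sys A).V ≃ₗ[ℝ] (Fin (d + 1) → ℝ)}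
    (hL : (𝒯.sys A).IsBallCoordinates d L) : Odd d := by
  have := h.even_K hA
  rw [hL.K_eq] at this
  simpa [Nat.even_add_one] using this

end Theory

end GPT

/-! ### Invariant bilinear forms on ball coordinates -/

/-- In odd dimension an alternating form has a nonzero vector in its kernel. -/
theorem exists_ne_zero_forall_apply_eq_zero_of_odd {d : ℕ} (hd : Odd d)
    (a : (Fin d → ℝ) →ₗ[ℝ] (Fin d → ℝ) →ₗ[ℝ] ℝ) (ha : ∀ x y, a x y = -a y x) :
    ∃ v, v ≠ 0 ∧ ∀ x, a x v = 0 := by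
  set M : Matrix (Fin d) (Fin d) ℝ := Matrix.of fun i j => a (Pi.single i 1) (Pi.single j 1)
    with hM
  have hT : M.transpose = -M := by
    ext i j
    simp [hM, ha (Pi.single j 1)]
  have hdet : M.det = 0 := by
    have := congrArg Matrix.det hT
    rw [Matrix.det_transpose, Matrix.det_neg, Fintype.card_fin, hd.neg_one_pow] at this
    linarith
  obtain ⟨v, hv, hMv⟩ := Matrix.exists_mulVec_eq_zero_iff.2 hdet
  refine ⟨v, hv, fun x => ?_⟩
  have h1 : ∀ i, a (Pi.single i 1) v = 0 := by
    intro i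
    refine Eq.trans ?_ (congrFun hMv i)
    conv_lhs => rw [pi_eq_sum_univ' v, map_sum]
    simp [hM, Matrix.mulVec, dotProduct, mul_comm]
  rw [pi_eq_sum_univ' x, LinearMap.map_sum₂]
  exact Finset.sum_eq_zero fun i _ => by rw [LinearMap.map_smul₂, h1, smul_zero]

theorem exists_eq_smul_of_dotProduct {d : ℕ} (hd : 1 ≤ d) (x : Fin d → ℝ) :
    ∃ (r : ℝ) (u : Fin d → ℝ), u ⬝ᵥ u = 1 ∧ x = r • u := by
  by_cases hx : x = 0
  · obtain ⟨u, hu⟩ := GPT.System.exists_dotProduct_self_eq_one hd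
    exact ⟨0, u, hu, by rw [hx, zero_smul]⟩
  have hpos : 0 < x ⬝ᵥ x :=
    lt_of_le_of_ne (Finset.sum_nonneg fun i _ => mul_self_nonneg _)
      fun h => hx (dotProduct_self_eq_zero.1 h.symm)
  have hs := Real.sqrt_pos.2 hpos
  refine ⟨Real.sqrt (x ⬝ᵥ x), (Real.sqrt (x ⬝ᵥ x))⁻¹ • x, ?_, ?_⟩
  · rw [smul_dotProduct, dotProduct_smul, smul_eq_mul, smul_eq_mul]
    nth_rewrite 3 [← Real.mul_self_sqrt hpos.le]
    field_simp
  · rw [smul_smul, mul_inv_cancel₀ hs.ne', one_smul]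

/-- The inclusion `x ↦ (0, x)`. -/
def consZero (d : ℕ) : (Fin d → ℝ) →ₗ[ℝ] (Fin (d + 1) → ℝ) where
  toFun x := Fin.cons 0 x
  map_add' x y := by
    ext i
    refine Fin.cases ?_ (fun j => ?_) i <;> simp
  map_smul' c x := by
    ext i
    refine Fin.cases ?_ (fun j => ?_) i <;> simp

theorem consZero_apply_zero {d : ℕ} (x : Fin d → ℝ) : consZero d x 0 = 0 := rfl

theorem exists_eq_consZero {d : ℕ} {v : Fin (d + 1) → ℝ} (hv : v 0 = 0) :
    ∃ x, v = consZero d x :=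
  ⟨Fin.tail v, by
    ext i
    refine Fin.cases hv (fun j => ?_) i
    rfl⟩

theorem cons_eq_add_consZero {d : ℕ} (c : ℝ) (x : Fin d → ℝ) :
    (Fin.cons c x : Fin (d + 1) → ℝ) = c • Fin.cons 1 0 + consZero d x := by
  ext i
  refine Fin.cases ?_ (fun j => ?_) i <;> simp [consZero]

/-- Let `d` be odd and let `Γ` be a set of linear equivalences of `ℝ^(d+1)` that preserve the first
coordinate, fix the center `(1, 0)` of the ball and act transitively on the unit sphere. A
`Γ`-invariant bilinear form in which antipodal points `(1, x)`, `(1, -x)` of the sphere are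
orthogonal is a multiple of the dot product. The symmetric part of the form is determined by its
constant values on the sphere; the kernel of its alternating part on `ℝ^d` is nonzero as `d` is odd,
hence everything as `Γ` is transitive on directions. -/
theorem bilin_eq_mul_dotProduct_of_invariant {d : ℕ} (hd : Odd d)
    (m : (Fin (d + 1) → ℝ) →ₗ[ℝ] (Fin (d + 1) → ℝ) →ₗ[ℝ] ℝ)
    (Γ : Set ((Fin (d + 1) → ℝ) ≃ₗ[ℝ] (Fin (d + 1) → ℝ)))
    (hΓ0 : ∀ T ∈ Γ, ∀ v, T v 0 = v 0) (hΓc : ∀ T ∈ Γ, T (Fin.cons 1 0) = Fin.cons 1 0)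
    (hΓm : ∀ T ∈ Γ, ∀ v w, m (T v) (T w) = m v w)
    (htrans : ∀ x y : Fin d → ℝ, x ⬝ᵥ x = 1 → y ⬝ᵥ y = 1 →
      ∃ T ∈ Γ, T (Fin.cons 1 x) = Fin.cons 1 y)
    (hm : ∀ x : Fin d → ℝ, x ⬝ᵥ x = 1 → m (Fin.cons 1 x) (Fin.cons 1 (-x)) = 0)
    (v w : Fin (d + 1) → ℝ) : m v w = m (Fin.cons 1 0) (Fin.cons 1 0) * (v ⬝ᵥ w) := by
  have hd1 : 1 ≤ d := hd.pos
  set e : Fin (d + 1) → ℝ := Fin.cons 1 0 with he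
  set J := consZero d with hJ
  set lam := m e e with hlam
  have hcons : ∀ x : Fin d → ℝ, (Fin.cons 1 x : Fin (d + 1) → ℝ) = e + J x := fun x => by
    rw [cons_eq_add_consZero, one_smul]
  have htransJ : ∀ x y : Fin d → ℝ, x ⬝ᵥ x = 1 → y ⬝ᵥ y = 1 → ∃ T ∈ Γ, T (J x) = J y := by
    intro x y hx hy
    obtain ⟨T, hT, h⟩ := htrans x y hx hy
    rw [hcons, hcons, map_add, hΓc T hT] at h
    exact ⟨T, hT, add_left_cancel h⟩
  have hexp : ∀ x : Fin d → ℝ, x ⬝ᵥ x = 1 →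
      m (J x) (J x) = lam ∧ m e (J x) = m (J x) e := by
    intro x hx
    have h1 := hm x hx
    have h2 := hm (-x) (by simpa using hx)
    rw [neg_neg] at h2
    simp only [hcons, map_neg, map_add, LinearMap.add_apply, LinearMap.neg_apply] at h1 h2
    rw [← hlam] at h1 h2
    constructor <;> linarith
  have hsq : ∀ x, m (J x) (J x) = lam * (x ⬝ᵥ x) := by
    intro x
    obtain ⟨r, u, hu, rfl⟩ := exists_eq_smul_of_dotProduct hd1 x
    simp only [map_smul, LinearMap.smul_apply, smul_eq_mul, smul_dotProduct, dotProduct_smul,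
      (hexp u hu).1, hu]
    ring
  have hmixu : ∀ u : Fin d → ℝ, u ⬝ᵥ u = 1 → m e (J u) = 0 := by
    intro u hu
    obtain ⟨T, hT, hTu⟩ := htransJ u (-u) hu (by simpa using hu)
    have := hΓm T hT e (J u)
    rw [hΓc T hT, hTu, map_neg, map_neg] at this
    linarith
  have hmix : ∀ x, m e (J x) = 0 ∧ m (J x) e = 0 := by
    intro x
    obtain ⟨r, u, hu, rfl⟩ := exists_eq_smul_of_dotProduct hd1 x
    simp only [map_smul, LinearMap.smul_apply, ← (hexp u hu).2, hmixu u hu, smul_zero, and_self]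
  -- the alternating part of `m` on `ℝ^d`
  set a : (Fin d → ℝ) →ₗ[ℝ] (Fin d → ℝ) →ₗ[ℝ] ℝ := (m - m.flip).compl₁₂ J J with ha
  have haxy : ∀ x y, a x y = m (J x) (J y) - m (J y) (J x) := fun x y => by simp [ha]
  obtain ⟨v₀, hv₀, hker⟩ := exists_ne_zero_forall_apply_eq_zero_of_odd hd a fun x y => by
    rw [haxy, haxy]; ring
  obtain ⟨r, u₀, hu₀, rfl⟩ := exists_eq_smul_of_dotProduct hd1 v₀
  have hr : r ≠ 0 := by rintro rfl; simp at hv₀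
  have hker₀ : ∀ x, a x u₀ = 0 := fun x => by
    have := hker x
    rw [map_smul, smul_eq_mul] at this
    exact (mul_eq_zero.1 this).resolve_left hr
  have hzero : ∀ x y, a x y = 0 := by
    intro x y
    obtain ⟨r, u, hu, rfl⟩ := exists_eq_smul_of_dotProduct hd1 y
    obtain ⟨T, hT, hTu⟩ := htransJ u₀ u hu₀ hu
    obtain ⟨x', hx'⟩ := exists_eq_consZero (v := T.symm (J x)) (by
      rw [← hΓ0 T hT (T.symm (J x)), T.apply_symm_apply]; exact consZero_apply_zero x)
    have hTx : T (J x') = J x := by rw [hJ, ← hx', T.apply_symm_apply]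
    have h1 := hker₀ x'
    rw [haxy, ← hΓm T hT, ← hΓm T hT (J u₀), hTx, hTu, ← haxy] at h1
    rw [map_smul, h1, smul_zero]
  have hJJ : ∀ x y, m (J x) (J y) = lam * (x ⬝ᵥ y) := by
    intro x y
    have h1 := hsq (x + y)
    have h2 := hzero x y
    rw [haxy] at h2
    simp only [map_add, LinearMap.add_apply, hsq, add_dotProduct, dotProduct_add,
      dotProduct_comm y x] at h1
    linarith
  obtain ⟨c, x, rfl⟩ : ∃ c x, v = Fin.cons c x := ⟨v 0, Fin.tail v, (Fin.cons_self_tail v).symm⟩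
  obtain ⟨c', y, rfl⟩ : ∃ c x, w = Fin.cons c x := ⟨w 0, Fin.tail w, (Fin.cons_self_tail w).symm⟩
  have hdot : (Fin.cons c x : Fin (d + 1) → ℝ) ⬝ᵥ Fin.cons c' y = c * c' + x ⬝ᵥ y := by
    simp [dotProduct, Fin.sum_univ_succ]
  rw [hdot, cons_eq_add_consZero c, cons_eq_add_consZero c']
  simp only [← he, ← hJ, map_add, map_smul, LinearMap.add_apply, LinearMap.smul_apply, smul_eq_mul,
    (hmix _).1, (hmix _).2, hJJ, ← hlam]
  ring

/-! ### Invariant bilinear forms on the composite of two bits -/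

namespace GPT

open GPT.System

namespace Theory

variable {𝒯 : Theory}

/-- The reversible transformations of a bit in ball coordinates. -/
def coordGroup (A : System) {d : ℕ} (L : A.V ≃ₗ[ℝ] (Fin (d + 1) → ℝ)) :
    Set ((Fin (d + 1) → ℝ) ≃ₗ[ℝ] (Fin (d + 1) → ℝ)) :=
  {T | ∃ S ∈ A.G, T = L.symm.trans (S.toLinearEquiv.trans L)}

/-- The criterion for multiples of the dot product, for the reversible transformations of a bit. -/
theorem Postulates.bilin_eq_mul_dotProduct (h : 𝒯.Postulates) {A : 𝒯.Sys}
    (hA : (𝒯.sys A).HasCapacity 2) {d : ℕ} {L : (𝒯.sys A).V ≃ₗ[ℝ] (Fin (d + 1) → ℝ)}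
    (hL : (𝒯.sys A).IsBallCoordinates d L)
    (m : (𝒯.sys A).V →ₗ[ℝ] (𝒯.sys A).V →ₗ[ℝ] ℝ)
    (hinv : ∀ S ∈ (𝒯.sys A).G, ∀ v w, m (S v) (S w) = m v w)
    (hm : ∀ x : Fin d → ℝ, x ⬝ᵥ x = 1 → m (ballPoint L x) (ballPoint L (-x)) = 0)
    (v w : (𝒯.sys A).V) : m v w = m (ballPoint L 0) (ballPoint L 0) * (L v ⬝ᵥ L w) := by
  have key := bilin_eq_mul_dotProduct_of_invariant (h.odd_of_isBallCoordinates hA hL)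
    (m.compl₁₂ L.symm.toLinearMap L.symm.toLinearMap) (coordGroup (𝒯.sys A) L) ?_ ?_ ?_ ?_ ?_
    (L v) (L w)
  · simpa [ballPoint] using key
  · rintro _ ⟨S, hS, rfl⟩ v
    change L (S (L.symm v)) 0 = v 0
    rw [← hL.unit_apply, unit_apply_of_mem_G hS, hL.unit_apply, L.apply_symm_apply]
  · rintro _ ⟨S, hS, rfl⟩
    change L (S (ballPoint L 0)) = Fin.cons 1 0
    rw [hL.isInvariantState_center.2 S hS, apply_ballPoint]
  · rintro _ ⟨S, hS, rfl⟩ v w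
    simpa using hinv S hS (L.symm v) (L.symm w)
  · intro x y hx hy
    have hp : ∀ x : Fin d → ℝ, x ⬝ᵥ x = 1 → ballPoint L x ∈ (𝒯.sys A).pureStates := fun x hx =>
      h.mem_pureStates hA (hL.distinguishes (h.allBitEffectsAllowed A hA) hx) 0
    obtain ⟨S, hS, hSx⟩ := h.isSymmetric A _ (hp x hx) _ (hp y hy)
    refine ⟨_, ⟨S, hS, rfl⟩, ?_⟩
    change L (S (ballPoint L x)) = Fin.cons 1 y
    rw [hSx, apply_ballPoint]
  · intro x hx
    simpa [ballPoint] using hm x hx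

/-- A functional on a bit that vanishes on the unit sphere is zero. -/
theorem linearMap_eq_zero_of_ballPoint {A : System} {d : ℕ} (hd : 1 ≤ d)
    {L : A.V ≃ₗ[ℝ] (Fin (d + 1) → ℝ)} (f : A.V →ₗ[ℝ] ℝ)
    (hf : ∀ x : Fin d → ℝ, x ⬝ᵥ x = 1 → f (ballPoint L x) = 0) : f = 0 := by
  have hcons : ∀ x : Fin d → ℝ,
      ballPoint L x = ballPoint L 0 + L.symm (consZero d x) := fun x => by
    rw [ballPoint, cons_eq_add_consZero, one_smul, map_add]; rfl
  have h0 : f (ballPoint L 0) = 0 := by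
    obtain ⟨x, hx⟩ := exists_dotProduct_self_eq_one hd
    have := congrArg f (ballPoint_add_ballPoint_neg (L := L) x)
    rw [map_add, map_smul, hf x hx, hf (-x) (by simpa using hx)] at this
    simpa using this.symm
  have hJ : ∀ x : Fin d → ℝ, f (L.symm (consZero d x)) = 0 := by
    intro x
    obtain ⟨r, u, hu, rfl⟩ := exists_eq_smul_of_dotProduct hd x
    have := hf u hu
    rw [hcons, map_add, h0, zero_add] at this
    rw [map_smul, map_smul, map_smul, this, smul_zero]
  refine LinearMap.ext fun v => ?_
  obtain ⟨x, rfl⟩ := L.symm.surjective v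
  obtain ⟨c, x, rfl⟩ : ∃ c y, x = Fin.cons c y := ⟨x 0, Fin.tail x, (Fin.cons_self_tail x).symm⟩
  rw [cons_eq_add_consZero, map_add, map_smul, map_add, map_smul, hJ]
  have : f (L.symm (Fin.cons 1 0)) = 0 := h0
  rw [this]; simp

section TwoBits

variable {A B : 𝒯.Sys} {d : ℕ} {LA : (𝒯.sys A).V ≃ₗ[ℝ] (Fin (d + 1) → ℝ)}
  {LB : (𝒯.sys B).V ≃ₗ[ℝ] (Fin (d + 1) → ℝ)}

/-- Four distinguishable product states of two bits, with the basis `±y` of the second bit if the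
first one is in the state `x`, and the basis `±y'` if it is in the state `-x`. An invariant form
pairs the first of them with each other one to the same value, as the stabilizer of the first is
transitive on the others. Since the four states mix to the maximally mixed state, this value is
determined by `p` and `r`. -/
theorem Postulates.apply_quadruple (h : 𝒯.Postulates) (hA : (𝒯.sys A).HasCapacity 2)
    (hB : (𝒯.sys B).HasCapacity 2) (hLA : (𝒯.sys A).IsBallCoordinates d LA)
    (hLB : (𝒯.sys B).IsBallCoordinates d LB)
    (g : (𝒯.sys (𝒯.comp A B)).V →ₗ[ℝ] (𝒯.sys (𝒯.comp A B)).V →ₗ[ℝ] ℝ)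
    (hg : ∀ T ∈ (𝒯.sys (𝒯.comp A B)).G, ∀ v w, g (T v) (T w) = g v w) {p r : ℝ}
    (hp : ∀ ω ∈ (𝒯.sys (𝒯.comp A B)).pureStates, g ω ω = p)
    (hr : ∀ ω ∈ (𝒯.sys (𝒯.comp A B)).pureStates,
      g ω ((𝒯.composite A B).st (ballPoint LA 0) (ballPoint LB 0)) = r)
    {x y y' : Fin d → ℝ} (hx : x ⬝ᵥ x = 1) (hy : y ⬝ᵥ y = 1) (hy' : y' ⬝ᵥ y' = 1) :
    g ((𝒯.composite A B).st (ballPoint LA x) (ballPoint LB y))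
        ((𝒯.composite A B).st (ballPoint LA x) (ballPoint LB (-y))) = (4 * r - p) / 3 ∧
      g ((𝒯.composite A B).st (ballPoint LA x) (ballPoint LB y))
        ((𝒯.composite A B).st (ballPoint LA (-x)) (ballPoint LB y')) = (4 * r - p) / 3 := by
  set C := 𝒯.composite A B
  have hC : C.LocallyTomographic := h.localTomography A B
  have hallA := h.allBitEffectsAllowed A hA
  have hallB := h.allBitEffectsAllowed B hB
  have hcap : (𝒯.sys (𝒯.comp A B)).HasCapacity (3 + 1) :=
    (h.hasMixingBasis_comp (h.hasMixingBasis_two hA) (h.hasMixingBasis_two hB)).1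
  have hneg : ∀ {z : Fin d → ℝ}, z ⬝ᵥ z = 1 → (-z) ⬝ᵥ (-z) = 1 := fun hz => by simpa using hz
  have hEA : ∀ {z : Fin d → ℝ}, z ⬝ᵥ z = 1 → ballEffect LA z ∈ (𝒯.sys A).effects :=
    fun hz => hallA _ fun _ => hLA.ballEffect_mem_Icc hz
  have hEB : ∀ {z : Fin d → ℝ}, z ⬝ᵥ z = 1 → ballEffect LB z ∈ (𝒯.sys B).effects :=
    fun hz => hallB _ fun _ => hLB.ballEffect_mem_Icc hz
  set E : Fin (3 + 1) → ((𝒯.sys (𝒯.comp A B)).V →L[ℝ] ℝ) :=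
    ![C.eff (ballEffect LA x) (ballEffect LB y), C.eff (ballEffect LA x) (ballEffect LB (-y)),
      C.eff (ballEffect LA (-x)) (ballEffect LB y'),
      C.eff (ballEffect LA (-x)) (ballEffect LB (-y'))] with hE
  set ω : Fin (3 + 1) → (𝒯.sys (𝒯.comp A B)).V :=
    ![C.st (ballPoint LA x) (ballPoint LB y), C.st (ballPoint LA x) (ballPoint LB (-y)),
      C.st (ballPoint LA (-x)) (ballPoint LB y'),
      C.st (ballPoint LA (-x)) (ballPoint LB (-y'))] with hω
  have hdist : (𝒯.sys (𝒯.comp A B)).Distinguishes E ω := by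
    refine ⟨⟨?_, ?_⟩, ?_, ?_⟩
    · intro i
      fin_cases i
      exacts [C.eff_mem _ (hEA hx) _ (hEB hy), C.eff_mem _ (hEA hx) _ (hEB (hneg hy)),
        C.eff_mem _ (hEA (hneg hx)) _ (hEB hy'), C.eff_mem _ (hEA (hneg hx)) _ (hEB (hneg hy'))]
    · rw [Fin.sum_univ_four]
      change C.eff (ballEffect LA x) (ballEffect LB y) +
        C.eff (ballEffect LA x) (ballEffect LB (-y)) +
        C.eff (ballEffect LA (-x)) (ballEffect LB y') +
        C.eff (ballEffect LA (-x)) (ballEffect LB (-y')) = _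
      rw [← map_add, add_assoc, ← map_add, hLB.ballEffect_add_neg, hLB.ballEffect_add_neg,
        ← LinearMap.map_add₂, hLA.ballEffect_add_neg, C.eff_unit]
    · have hpA : ∀ {z : Fin d → ℝ}, z ⬝ᵥ z = 1 → ballPoint LA z ∈ (𝒯.sys A).states :=
        fun hz => hLA.ballPoint_mem hz.le
      have hpB : ∀ {z : Fin d → ℝ}, z ⬝ᵥ z = 1 → ballPoint LB z ∈ (𝒯.sys B).states :=
        fun hz => hLB.ballPoint_mem hz.le
      intro i
      fin_cases i
      exacts [C.st_mem _ (hpA hx) _ (hpB hy), C.st_mem _ (hpA hx) _ (hpB (hneg hy)),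
        C.st_mem _ (hpA (hneg hx)) _ (hpB hy'), C.st_mem _ (hpA (hneg hx)) _ (hpB (hneg hy'))]
    · intro i j
      fin_cases i <;> fin_cases j <;>
        simp [hE, hω, C.eff_st, ballEffect_ballPoint, hx, hy, hy']
  have hμ : (𝒯.sys (𝒯.comp A B)).IsInvariantState (C.st (ballPoint LA 0) (ballPoint LB 0)) := by
    obtain ⟨μ, hμ⟩ := (𝒯.sys (𝒯.comp A B)).exists_isInvariantState
    rwa [← C.eq_st_of_isInvariantState hC (h.isSymmetric A) (h.isSymmetric B)
      hLA.isInvariantState_center hLB.isInvariantState_center hμ]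
  have hsum : ∑ i, ω i = ((3 + 1 : ℕ) : ℝ) • C.st (ballPoint LA 0) (ballPoint LB 0) := by
    rw [Fin.sum_univ_four]
    change C.st (ballPoint LA x) (ballPoint LB y) + C.st (ballPoint LA x) (ballPoint LB (-y)) +
      C.st (ballPoint LA (-x)) (ballPoint LB y') + C.st (ballPoint LA (-x)) (ballPoint LB (-y')) = _
    rw [← map_add, add_assoc, ← map_add, ballPoint_add_ballPoint_neg, ballPoint_add_ballPoint_neg,
      ← LinearMap.map_add₂, ballPoint_add_ballPoint_neg, map_smul, LinearMap.map_smul₂, smul_smul]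
    norm_num
  have hpure := h.mem_pureStates hcap hdist
  have hmove : ∀ k : Fin (3 + 1), k ≠ 0 → g (ω 0) (ω 1) = g (ω 0) (ω k) := by
    intro k hk
    obtain ⟨T, hT, h0, h1⟩ := h.exists_fix_move hcap hdist hμ hsum (j := 0) (k := 1) (l := k)
      (by decide) hk
    rw [← hg T hT, h0, h1]
  have h2 := hmove 2 (by decide)
  have h3 := hmove 3 (by decide)
  have htot := congrArg (g (ω 0)) hsum
  rw [Fin.sum_univ_four, map_add, map_add, map_add, map_smul, hp _ (hpure 0), hr _ (hpure 0),
    ← h2, ← h3, smul_eq_mul] at htot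
  push_cast at htot
  have h4 : g (ω 0) (ω 1) = (4 * r - p) / 3 := by linarith
  exact ⟨h4, h2.symm.trans h4⟩

/-- Up to a multiple of `(v, w) ↦ 𝟏 v * 𝟏 w`, which makes distinguishable pure states orthogonal, an
invariant inner product on the composite of two bits is a nonzero multiple of the dot product in the
product coordinates; in particular the latter is invariant. -/
theorem Postulates.dotProduct_invariant (h : 𝒯.Postulates) (hA : (𝒯.sys A).HasCapacity 2)
    (hB : (𝒯.sys B).HasCapacity 2) (hLA : (𝒯.sys A).IsBallCoordinates d LA)
    (hLB : (𝒯.sys B).IsBallCoordinates d LB)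
    {Φ : (𝒯.sys (𝒯.comp A B)).V ≃ₗ[ℝ] (Fin (d + 1) × Fin (d + 1) → ℝ)}
    (hΦ : ∀ a b i j, Φ ((𝒯.composite A B).st a b) (i, j) = LA a i * LB b j)
    {T : (𝒯.sys (𝒯.comp A B)).V ≃L[ℝ] (𝒯.sys (𝒯.comp A B)).V} (hT : T ∈ (𝒯.sys (𝒯.comp A B)).G)
    (v w : (𝒯.sys (𝒯.comp A B)).V) : Φ (T v) ⬝ᵥ Φ (T w) = Φ v ⬝ᵥ Φ w := by
  set C := 𝒯.composite A B
  have hd : 1 ≤ d := hLA.one_le_dim hA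
  obtain ⟨Q, hQ⟩ := (𝒯.sys (𝒯.comp A B)).exists_euclidean
  set g : (𝒯.sys (𝒯.comp A B)).V →ₗ[ℝ] (𝒯.sys (𝒯.comp A B)).V →ₗ[ℝ] ℝ :=
    (innerₗ _).compl₁₂ Q.toLinearMap Q.toLinearMap
  have hgv : ∀ v w, g v w = inner ℝ (Q v) (Q w) := fun v w => rfl
  have hg : ∀ T ∈ (𝒯.sys (𝒯.comp A B)).G, ∀ v w, g (T v) (T w) = g v w :=
    fun T hT v w => hQ T hT v w
  have hμ : (𝒯.sys (𝒯.comp A B)).IsInvariantState (C.st (ballPoint LA 0) (ballPoint LB 0)) := by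
    obtain ⟨μ, hμ⟩ := (𝒯.sys (𝒯.comp A B)).exists_isInvariantState
    rwa [← C.eq_st_of_isInvariantState (h.localTomography A B) (h.isSymmetric A) (h.isSymmetric B)
      hLA.isInvariantState_center hLB.isInvariantState_center hμ]
  obtain ⟨ω₀, hω₀⟩ := (𝒯.sys (𝒯.comp A B)).pureStates_nonempty
  set p := g ω₀ ω₀
  set r := g ω₀ (C.st (ballPoint LA 0) (ballPoint LB 0))
  have hp : ∀ ω ∈ (𝒯.sys (𝒯.comp A B)).pureStates, g ω ω = p := by
    intro ω hω
    obtain ⟨S, hS, rfl⟩ := h.isSymmetric _ ω₀ hω₀ ω hω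
    exact hg S hS _ _
  have hr : ∀ ω ∈ (𝒯.sys (𝒯.comp A B)).pureStates,
      g ω (C.st (ballPoint LA 0) (ballPoint LB 0)) = r := by
    intro ω hω
    obtain ⟨S, hS, rfl⟩ := h.isSymmetric _ ω₀ hω₀ ω hω
    have := hg S hS ω₀ (C.st (ballPoint LA 0) (ballPoint LB 0))
    rwa [hμ.2 S hS] at this
  set q := (4 * r - p) / 3 with hq
  have hquad := fun {x y y' : Fin d → ℝ} => h.apply_quadruple (x := x) (y := y) (y' := y')
    hA hB hLA hLB g hg hp hr
  -- the form in which distinguishable pure states are orthogonal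
  set U : (𝒯.sys (𝒯.comp A B)).V →ₗ[ℝ] ℝ := 
    ((𝒯.sys (𝒯.comp A B)).unit : (𝒯.sys (𝒯.comp A B)).V →ₗ[ℝ] ℝ)
  set G := g - q • (LinearMap.mul ℝ ℝ).compl₁₂ U U with hGdef
  have hGv : ∀ v w, G v w = g v w - q * (U v * U w) := fun v w => by simp [hGdef]
  have hG : ∀ T ∈ (𝒯.sys (𝒯.comp A B)).G, ∀ v w, G (T v) (T w) = G v w := by
    intro S hS v w
    have hUS : ∀ v, U (S v) = U v := fun v => unit_apply_of_mem_G hS v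
    rw [hGv, hGv, hg S hS, hUS, hUS]
  have hUst : ∀ {x y : Fin d → ℝ}, x ⬝ᵥ x = 1 → y ⬝ᵥ y = 1 →
      U (C.st (ballPoint LA x) (ballPoint LB y)) = 1 := fun hx hy =>
    (𝒯.sys (𝒯.comp A B)).states_normalized _
      (C.st_mem _ (hLA.ballPoint_mem hx.le) _ (hLB.ballPoint_mem hy.le))
  have hneg : ∀ {z : Fin d → ℝ}, z ⬝ᵥ z = 1 → (-z) ⬝ᵥ (-z) = 1 := fun hz => by simpa using hz
  have hG1 : ∀ {x y : Fin d → ℝ}, x ⬝ᵥ x = 1 → y ⬝ᵥ y = 1 →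
      G (C.st (ballPoint LA x) (ballPoint LB y)) (C.st (ballPoint LA x) (ballPoint LB (-y))) = 0 :=
    fun hx hy => by
      rw [hGv, hUst hx hy, hUst hx (hneg hy), (hquad hx hy hy).1]; ring
  have hG2 : ∀ x : Fin d → ℝ, x ⬝ᵥ x = 1 → ∀ β β',
      G (C.st (ballPoint LA x) β) (C.st (ballPoint LA (-x)) β') = 0 := by
    intro x hx β β'
    have h1 : ∀ y : Fin d → ℝ, y ⬝ᵥ y = 1 → ∀ β',
        G (C.st (ballPoint LA x) (ballPoint LB y)) (C.st (ballPoint LA (-x)) β') = 0 := by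
      intro y hy β'
      refine LinearMap.congr_fun (linearMap_eq_zero_of_ballPoint (L := LB) hd
        (G (C.st (ballPoint LA x) (ballPoint LB y)) ∘ₗ C.st (ballPoint LA (-x)))
        fun y' hy' => ?_) β'
      change G _ (C.st (ballPoint LA (-x)) (ballPoint LB y')) = 0
      rw [hGv, hUst hx hy, hUst (hneg hx) hy', (hquad hx hy hy').2]; ring
    exact LinearMap.congr_fun (linearMap_eq_zero_of_ballPoint (L := LB) hd
      (G.flip (C.st (ballPoint LA (-x)) β') ∘ₗ C.st (ballPoint LA x))
      fun y hy => h1 y hy β') β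
  have hfac1 : ∀ β β' α α', G (C.st α β) (C.st α' β') =
      G (C.st (ballPoint LA 0) β) (C.st (ballPoint LA 0) β') * (LA α ⬝ᵥ LA α') := by
    intro β β' α α'
    refine h.bilin_eq_mul_dotProduct hA hLA (G.compl₁₂ (C.st.flip β) (C.st.flip β')) ?_ ?_ α α'
    · intro S hS a a'
      obtain ⟨R, hR, h1, -⟩ := C.local_trans S hS 1 (one_mem _)
      have e1 : C.st (S a) β = R (C.st a β) := (h1 a β).symm
      have e2 : C.st (S a') β' = R (C.st a' β') := (h1 a' β').symm
      simp only [LinearMap.compl₁₂_apply, LinearMap.flip_apply]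
      rw [e1, e2, hG R hR]
    · intro x hx
      exact hG2 x hx β β'
  set κ := G (C.st (ballPoint LA 0) (ballPoint LB 0)) (C.st (ballPoint LA 0) (ballPoint LB 0))
  obtain ⟨x₀, hx₀⟩ := exists_dotProduct_self_eq_one hd
  have hLAx : LA (ballPoint LA x₀) ⬝ᵥ LA (ballPoint LA x₀) = 2 := by
    rw [apply_ballPoint]
    have : ∑ i, x₀ i * x₀ i = 1 := hx₀
    simp [dotProduct, Fin.sum_univ_succ, this]; norm_num
  have hfac2 : ∀ β β', G (C.st (ballPoint LA 0) β) (C.st (ballPoint LA 0) β') =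
      κ * (LB β ⬝ᵥ LB β') := by
    intro β β'
    refine h.bilin_eq_mul_dotProduct hB hLB
      (G.compl₁₂ (C.st (ballPoint LA 0)) (C.st (ballPoint LA 0))) ?_ ?_ β β'
    · intro S hS b b'
      obtain ⟨R, hR, h1, -⟩ := C.local_trans 1 (one_mem _) S hS
      have e : ∀ b, C.st (ballPoint LA 0) (S b) = R (C.st (ballPoint LA 0) b) :=
        fun b => (h1 _ b).symm
      simp only [LinearMap.compl₁₂_apply]
      rw [e, e, hG R hR]
    · intro y hy
      have h1 := hG1 hx₀ hy
      rw [hfac1, hLAx] at h1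
      simpa using h1
  have hfac : ∀ α β α' β', G (C.st α β) (C.st α' β') = κ * (LA α ⬝ᵥ LA α') * (LB β ⬝ᵥ LB β') := by
    intro α β α' β'
    rw [hfac1, hfac2]; ring
  have hΦst : ∀ a b a' b', Φ (C.st a b) ⬝ᵥ Φ (C.st a' b') = (LA a ⬝ᵥ LA a') * (LB b ⬝ᵥ LB b') := by
    intro a b a' b'
    simp only [dotProduct, Fintype.sum_prod_type, hΦ, Finset.sum_mul_sum]
    exact Finset.sum_congr rfl fun i _ => Finset.sum_congr rfl fun j _ => by ring
  have hsingle : ∀ k : Fin (d + 1) × Fin (d + 1), Φ.symm (Pi.single k 1) =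
      C.st (LA.symm (Pi.single k.1 1)) (LB.symm (Pi.single k.2 1)) := by
    intro k
    rw [LinearEquiv.symm_apply_eq]
    ext ⟨i, j⟩
    rw [hΦ, LA.apply_symm_apply, LB.apply_symm_apply]
    by_cases h1 : i = k.1 <;> by_cases h2 : j = k.2 <;> simp [h1, h2, Prod.ext_iff]
  have hGΦ : ∀ v w, G v w = κ * (Φ v ⬝ᵥ Φ w) := by
    have : G = κ • (dotProductBilin ℝ ℝ).compl₁₂ Φ.toLinearMap Φ.toLinearMap := by
      refine LinearMap.ext_basis ((Pi.basisFun ℝ _).map Φ.symm) ((Pi.basisFun ℝ _).map Φ.symm)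
        fun k l => ?_
      simp only [Module.Basis.map_apply, Pi.basisFun_apply, LinearMap.smul_apply,
        LinearMap.compl₁₂_apply, hsingle]
      rw [hfac]
      change _ = κ * (Φ _ ⬝ᵥ Φ _)
      rw [hΦst, mul_assoc]
    intro v w
    rw [this]; rfl
  have hκ : κ ≠ 0 := by
    intro h0
    set ω := C.st (ballPoint LA x₀) (ballPoint LB x₀)
    set φ := C.st (ballPoint LA x₀) (ballPoint LB (-x₀))
    have hz : ω - φ = 0 := by
      have h1 : G (ω - φ) (ω - φ) = 0 := by rw [hGΦ, h0, zero_mul]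
      rw [hGv, map_sub U, hUst hx₀ hx₀, hUst hx₀ (hneg hx₀), sub_self, mul_zero, mul_zero,
        sub_zero, hgv] at h1
      exact Q.map_eq_zero_iff.1 (inner_self_eq_zero.1 h1)
    have h2 : Φ ω ⬝ᵥ Φ ω = Φ ω ⬝ᵥ Φ φ := by rw [sub_eq_zero.1 hz]
    rw [hΦst, hΦst, hLAx] at h2
    simp only [apply_ballPoint] at h2
    have h3 : ∑ i, x₀ i * x₀ i = 1 := hx₀
    simp [dotProduct, Fin.sum_univ_succ, h3] at h2
  have := hG T hT v w
  rw [hGΦ, hGΦ] at this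
  exact mul_left_cancel₀ hκ this

end TwoBits

end Theory

end GPT

theorem mainTheorem5 (𝒯 : GPT.Theory) (h𝒯 : 𝒯.Postulates) (A B : 𝒯.Sys)
    (hA : (𝒯.sys A).HasCapacity 2) (hB : (𝒯.sys B).HasCapacity 2) :
    (∃ (d : ℕ) (LA : (𝒯.sys A).V ≃ₗ[ℝ] (Fin (d + 1) → ℝ))
        (LB : (𝒯.sys B).V ≃ₗ[ℝ] (Fin (d + 1) → ℝ)),
      (𝒯.sys A).IsBallCoordinates d LA ∧ (𝒯.sys B).IsBallCoordinates d LB) ∧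
    ∀ (d : ℕ) (LA : (𝒯.sys A).V ≃ₗ[ℝ] (Fin (d + 1) → ℝ))
      (LB : (𝒯.sys B).V ≃ₗ[ℝ] (Fin (d + 1) → ℝ)),
      (𝒯.sys A).IsBallCoordinates d LA → (𝒯.sys B).IsBallCoordinates d LB →
      ∃ Φ : (𝒯.sys (𝒯.comp A B)).V ≃ₗ[ℝ] (Fin (d + 1) × Fin (d + 1) → ℝ),
        (∀ a b i j, Φ ((𝒯.composite A B).st a b) (i, j) = LA a i * LB b j) ∧
        ∀ T ∈ (𝒯.sys (𝒯.comp A B)).G,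
          LinearMap.toMatrix'
              (Φ.toLinearMap ∘ₗ (T : (𝒯.sys (𝒯.comp A B)).V →ₗ[ℝ] (𝒯.sys (𝒯.comp A B)).V) ∘ₗ
                Φ.symm.toLinearMap)
            ∈ Matrix.orthogonalGroup (Fin (d + 1) × Fin (d + 1)) ℝ := by
  constructor
  · obtain ⟨O, hO⟩ := 𝒯.exists_capacity 1 le_rfl
    have hKA : (𝒯.sys A).K = ((𝒯.sys A).K - 1) + 1 := by
      have := h𝒯.K_lt_of_succ hA hO
      omega
    have hKB : (𝒯.sys B).K = ((𝒯.sys A).K - 1) + 1 := by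
      rw [← hKA, h𝒯.K_eq_of_hasCapacity hA hB]
    obtain ⟨LA, hLA⟩ := h𝒯.exists_isBallCoordinates hA hKA
    obtain ⟨LB, hLB⟩ := h𝒯.exists_isBallCoordinates hB hKB
    exact ⟨_, LA, LB, hLA, hLB⟩
  · intro d LA LB hLA hLB
    obtain ⟨Φ, hΦ⟩ := (𝒯.composite A B).exists_coordinates (h𝒯.localTomography A B) LA LB
    refine ⟨Φ, hΦ, fun T hT => ?_⟩
    set M := LinearMap.toMatrix' (Φ.toLinearMap ∘ₗ
      (T : (𝒯.sys (𝒯.comp A B)).V →ₗ[ℝ] (𝒯.sys (𝒯.comp A B)).V) ∘ₗ Φ.symm.toLinearMap)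
    have hM : ∀ x, M.mulVec x = Φ (T (Φ.symm x)) := fun x => LinearMap.toMatrix'_mulVec _ x
    rw [Matrix.mem_orthogonalGroup_iff']
    refine Matrix.ext_of_mulVec_single fun k => ?_
    refine dotProduct_eq _ _ fun x => ?_
    rw [dotProduct_comm, dotProduct_comm _ x, ← Matrix.mulVec_mulVec, Matrix.dotProduct_mulVec,
      Matrix.vecMul_transpose, hM, hM, h𝒯.dotProduct_invariant hA hB hLA hLB hΦ hT,
      Φ.apply_symm_apply, Φ.apply_symm_apply, Matrix.one_mulVec]
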